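/- Let $M$ be a compact smooth Riemannian manifold with distance $d$, let $f:M\to M$ be a $C^\infty$ diffeomorphism, and let $\Lambda\subset M$ be a compact $f$-invariant hyperbolic set, i.e. $T_\Lambda M=E^s\oplus E^u$ with $Df$-invariant subbundles such that, for some $C,\theta>0$, $\|Df^{n}v\|\le Ce^{-\theta n}\|v\|$ for $v\in E^s$, $n\ge 0$, and $\|Df^{-n}v\|\le Ce^{-\theta n}\|v\|$ for $v\in E^u$, $n\ge 0$. Put $W^s_\varepsilon(x)=\{y: d(f^ny,f^nx)\le\varepsilon\ \forall n\ge 0\}$ and $W^u_\varepsilon(x)=\{y: d(f^{-n}y,f^{-n}x)\le\varepsilon\ \forall n\ge 0\}$. Assume, as usual for hyperbolic diffeomorphisms, that periodic points of $f$ are dense in $\Lambda$ and that $\Lambda$ has local product structure: for all small $\varepsilon>0$ there is $\delta>0$ such that for $x,y\in\Lambda$ with $d(x,y)\le\delta$ the set $W^s_\varepsilon(x)\cap W^u_\varepsilon(y)$ is a single point and this point lies in $\Lambda$. Assume that $\Lambda$ is a Cantor set. For a $C^\infty$ function $r:M\to(0,\infty)$ let $\Lambda_r=(\Lambda\times\mathbb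 R)/{\sim}$, $(x,u+r(x))\sim(f(x),u)$, be the suspension space with the suspension flow $\phi_t(x,u)=(x,u+t)$. Write $F(x,u)=(f(x),u-r(x))$. In the coordinates $(x,u)$, the local stable manifold $W^s_{\varepsilon}(x,u)$ of the flow consists of the $(y,u')$ with $y\in W^s_\varepsilon(x)$ and $d(F^n(y,u'),F^n(x,u))\to0$ as $n\to+\infty$, and the local unstable manifold $W^u_{\varepsilon}(x,u)$ consists of the $(y,u')$ with $y\in W^u_\varepsilon(x)$ and $d(F^{-n}(y,u'),F^{-n}(x,u))\to0$ as $n\to+\infty$ (with the product distance on $M\times\mathbb R$). Given $z_0=(x_0,u_0)$ with $x_0\in\Lambda$ and scales $\delta,\varepsilon$, for $z_1\in W^u_\delta(z_0)$ and $z_2\in W^s_\delta(z_0)$ over $\Lambda$ the temporal distance $\mathcal T(z_1,z_2)$ is the real number $T$ such that $\phi_T(z_3)=z_4$ (in coordinates) for some $z_3\in W^u_\varepsilon(z_2)$ and $z_4\in W^s_\varepsilon(z_1)$ over $\Lambda$; $\mathrm{range}(\mathcal T)$ is the set of all its values. **Theorem.** For every sufficiently small $\varepsilon>0$, every sufficiently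 small $\delta>0$ (depending on $\varepsilon$), and every $x_0\in\Lambda$, the following hold. 1. For all $\alpha,\beta\in\mathbb R$ there is a positive $C^\infty$ roof function $r:M\to\mathbb R$ such that, for every base point $z_0=(x_0,u_0)$, $u_0\in\mathbb R$, the temporal distance function $\mathcal T$ is well defined (the number $T$ above exists and is unique for every pair $(z_1,z_2)$) and $$\mathrm{range}(\mathcal T)=\{0,\pm\alpha,\pm\beta\}.$$ 2. In particular there is a positive $C^\infty$ roof function $r:M\to\mathbb R$ such that, for every $u_0\in\mathbb R$, $\mathcal T$ is well defined, there are $a,b\in\mathrm{range}(\mathcal T)$ with $a/b$ Diophantine, and $\mathrm{range}(\mathcal T)$ has upper box dimension $0$. Here $\xi\in\mathbb R$ is Diophantine if there are $C,\gamma>0$ with $|q\xi-p|\ge C|q|^{-\gamma}$ for all $p\in\mathbb Z$ and all nonzero $q\in\mathbb Z$. -/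

import Mathlib

open Set Filter Topology Bundle
open scoped Manifold ContDiff ENNReal NNReal

noncomputable section

/-- A (topological) Cantor set: nonempty, compact, perfect and totally disconnected. -/
structure IsCantorSet {X : Type*} [TopologicalSpace X] (S : Set X) : Prop where
  nonempty : S.Nonempty
  isCompact : IsCompact S
  perfect : Perfect S
  totallyDisconnected : IsTotallyDisconnected S

/-- Forward asymptotic class of `x`: the (global) stable set
`W^s(x) = {y | d(gⁿ y, gⁿ x) → 0 as n → +∞}`.
The unstable set `W^u(x)` is the stable set of the inverse. -/
def stableSet {X : Type*} [EDist X] (g : X ≃ X) (x : X) : Set X :=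
  {y | Tendsto (fun n : ℕ => edist (g^[n] y) (g^[n] x)) atTop (𝓝 0)}

def unstableSet {X : Type*} [EDist X] (g : X ≃ X) (x : X) : Set X :=
  stableSet g.symm x

/-- Local stable set of size `ε` of a diffeomorphism,
`W^s_ε(x) = {y | d(gⁿ y, gⁿ x) ≤ ε for all n ≥ 0}`. -/
def localStableSet {X : Type*} [EDist X] (g : X ≃ X) (ε : ℝ≥0∞) (x : X) : Set X :=
  {y | ∀ n : ℕ, edist (g^[n] y) (g^[n] x) ≤ ε}

def localUnstableSet {X : Type*} [EDist X] (g : X ≃ X) (ε : ℝ≥0∞) (x : X) : Set X :=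
  localStableSet g.symm ε x

/-- `Λ` is a hyperbolic set of the `C^∞` diffeomorphism `f` of the Riemannian manifold `M`, on which
`f` is a hyperbolic diffeomorphism `f : Λ → Λ`: `Λ` is compact and invariant, `T_Λ M` splits into an
invariant contracting and an invariant expanding subbundle, periodic orbits are dense in `Λ`, and
`Λ` has a local product structure (canonical coordinates). -/
structure IsHyperbolicDiffeo {d : ℕ} {M : Type*} [EMetricSpace M]
    [ChartedSpace (EuclideanSpace ℝ (Fin d)) M]
    [RiemannianBundle (fun x : M => TangentSpace (𝓡 d) x)]
    (f : M ≃ₘ^∞⟮𝓡 d, 𝓡 d⟯ M) (Λ : Set M) : Prop where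
  isCompact : IsCompact Λ
  invariant : f '' Λ = Λ
  splitting : ∃ Es Eu : ∀ x : M, Submodule ℝ (TangentSpace (𝓡 d) x),
    (∀ x ∈ Λ, IsCompl (Es x) (Eu x)) ∧
    (∀ x ∈ Λ, (Es x).map (mfderiv (𝓡 d) (𝓡 d) f x).toLinearMap = Es (f x)) ∧
    (∀ x ∈ Λ, (Eu x).map (mfderiv (𝓡 d) (𝓡 d) f x).toLinearMap = Eu (f x)) ∧
    ∃ C > (0 : ℝ), ∃ θ > (0 : ℝ), ∀ x ∈ Λ, ∀ n : ℕ,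
      (∀ v ∈ Es x,
        ‖mfderiv (𝓡 d) (𝓡 d) (f^[n]) x v‖ ≤ C * Real.exp (-θ * n) * ‖v‖) ∧
      (∀ v ∈ Eu x,
        ‖mfderiv (𝓡 d) (𝓡 d) (f.symm^[n]) x v‖ ≤ C * Real.exp (-θ * n) * ‖v‖)
  dense_periodic : Λ ⊆ closure (Λ ∩ Function.periodicPts f)
  local_product : ∃ ε₀ > (0 : ℝ≥0∞), ∀ ε : ℝ≥0∞, 0 < ε → ε ≤ ε₀ → ∃ δ > (0 : ℝ≥0∞),
    ∀ x ∈ Λ, ∀ y ∈ Λ, edist x y ≤ δ →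
      ∃ z ∈ Λ, localStableSet f.toEquiv ε x ∩ localUnstableSet f.toEquiv ε y = {z}

/-! ### Suspension flows

Points of the suspension space `Λ_r` are written in coordinates `(x, u)`, `x ∈ Λ`, `u ∈ ℝ`, subject
to the identification `(x, u + r x) ∼ (f x, u)`, so `Λ_r = (Λ × ℝ) / ∼`. The suspension flow is
`φ_t (x, u) = (x, u + t)`. -/

/-- The identification map `(x, u) ↦ (f x, u - r x)`: both sides are coordinates of the same point
of the suspension space. Its `n`-th iterate is `(x, u) ↦ (fⁿ x, u - ∑_{i<n} r (fⁱ x))`, which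
rewrites `(x, u)` in the coordinates of the `n`-th lap. -/
def suspensionShift {M : Type*} (f : M ≃ M) (r : M → ℝ) : M × ℝ ≃ M × ℝ where
  toFun z := (f z.1, z.2 - r z.1)
  invFun z := (f.symm z.1, z.2 + r (f.symm z.1))
  left_inv z := by simp
  right_inv z := by simp

/-- Two coordinate pairs represent the same point of the suspension space. -/
def suspensionSetoid {M : Type*} (f : M ≃ M) (r : M → ℝ) (Λ : Set M) :
    Setoid {z : M × ℝ // z.1 ∈ Λ} where
  r z w := ∃ n : ℤ, ((suspensionShift f r) ^ n : Equiv.Perm (M × ℝ)) z.1 = w.1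
  iseqv :=
    { refl := fun z => ⟨0, by simp⟩
      symm := by
        rintro z w ⟨n, h⟩
        exact ⟨-n, by rw [← h, zpow_neg]; simp⟩
      trans := by
        rintro x y z ⟨n, h⟩ ⟨m, h'⟩
        exact ⟨m + n, by rw [zpow_add, Equiv.Perm.mul_apply, h, h']⟩ }

/-- The suspension space `Λ_r`. -/
def SuspensionSpace {M : Type*} (f : M ≃ M) (r : M → ℝ) (Λ : Set M) : Type _ :=
  Quotient (suspensionSetoid f r Λ)

/-- The suspension flow in coordinates. -/
def coordFlow {M : Type*} (t : ℝ) (z : M × ℝ) : M × ℝ := (z.1, z.2 + t)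

theorem suspensionShift_coordFlow {M : Type*} (f : M ≃ M) (r : M → ℝ) (t : ℝ) (z : M × ℝ) :
    suspensionShift f r (coordFlow t z) = coordFlow t (suspensionShift f r z) := by
  simp [suspensionShift, coordFlow]; ring

theorem suspensionShift_zpow_coordFlow {M : Type*} (f : M ≃ M) (r : M → ℝ) (t : ℝ) (n : ℤ)
    (z : M × ℝ) : ((suspensionShift f r) ^ n : Equiv.Perm (M × ℝ)) (coordFlow t z) =
      coordFlow t (((suspensionShift f r) ^ n : Equiv.Perm (M × ℝ)) z) := by
  let e : Equiv.Perm (M × ℝ) :=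
    ⟨coordFlow t, coordFlow (-t), fun z => by simp [coordFlow], fun z => by simp [coordFlow]⟩
  have h : Commute (suspensionShift f r : Equiv.Perm (M × ℝ)) e :=
    Equiv.ext fun z => suspensionShift_coordFlow f r t z
  exact congrArg (fun p : Equiv.Perm (M × ℝ) => p z) (h.zpow_left n)

/-- The suspension flow `φ_t` on the suspension space. -/
def suspensionFlow {M : Type*} (f : M ≃ M) (r : M → ℝ) (Λ : Set M) (t : ℝ) :
    SuspensionSpace f r Λ → SuspensionSpace f r Λ :=
  @Quotient.map _ _ (suspensionSetoid f r Λ) (suspensionSetoid f r Λ)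
    (fun z => ⟨coordFlow t z.1, z.2⟩) (by
      rintro z w ⟨n, h⟩
      exact ⟨n, by rw [suspensionShift_zpow_coordFlow, h]⟩)

theorem suspensionFlow_mk {M : Type*} (f : M ≃ M) (r : M → ℝ) (Λ : Set M) (t : ℝ)
    (z : {z : M × ℝ // z.1 ∈ Λ}) :
    suspensionFlow f r Λ t (Quotient.mk (suspensionSetoid f r Λ) z) =
      Quotient.mk (suspensionSetoid f r Λ) ⟨coordFlow t z.1, z.2⟩ :=
  rfl

/-- Local stable manifold of the suspension flow at the point with coordinates `z = (x, u)`: pairs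
`w = (y, u')` with `y` in the local stable set of size `ε` of `x` for `f`, such that the flow orbits
of `z` and `w` are forward asymptotic. The flow orbits are compared in the coordinates of the `n`-th
lap, as `n → ∞`; the flow time `t` cancels since both heights are increased by `t`. -/
def flowLocalStable {M : Type*} [EMetricSpace M] (f : M ≃ M) (r : M → ℝ) (ε : ℝ≥0∞)
    (z : M × ℝ) : Set (M × ℝ) :=
  {w | w.1 ∈ localStableSet f ε z.1 ∧ w ∈ stableSet (suspensionShift f r) z}

/-- Local unstable manifold of the suspension flow (asymptotic in backward time). -/
def flowLocalUnstable {M : Type*} [EMetricSpace M] (f : M ≃ M) (r : M → ℝ) (ε : ℝ≥0∞)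
    (z : M × ℝ) : Set (M × ℝ) :=
  {w | w.1 ∈ localUnstableSet f ε z.1 ∧ w ∈ unstableSet (suspensionShift f r) z}

/-- `T = 𝒯(z₁, z₂)` is the temporal distance of `z₁` and `z₂`: there are `z₃` in the local unstable
manifold of `z₂` and `z₄` in the local stable manifold of `z₁` with `φ_T z₃ = z₄` (`z₄` is the local
product `[z₁, z₂]`). The equation is required in coordinates, so that `T` is determined even if `z₃`
lies on a closed orbit. -/
def IsTemporalDistance {M : Type*} [EMetricSpace M] (f : M ≃ M) (r : M → ℝ) (Λ : Set M)
    (ε : ℝ≥0∞) (z₁ z₂ : M × ℝ) (T : ℝ) : Prop :=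
  ∃ z₃ z₄ : M × ℝ, z₃.1 ∈ Λ ∧ z₄.1 ∈ Λ ∧ z₃ ∈ flowLocalUnstable f r ε z₂ ∧
    z₄ ∈ flowLocalStable f r ε z₁ ∧ coordFlow T z₃ = z₄

/-- The domain of the temporal distance function based at `z₀`:
pairs `(z₁, z₂)`, `z₁ ∈ W^u_δ(z₀)`, `z₂ ∈ W^s_δ(z₀)`, of points of the suspension space. -/
def temporalDomain {M : Type*} [EMetricSpace M] (f : M ≃ M) (r : M → ℝ) (Λ : Set M)
    (δ : ℝ≥0∞) (z₀ : M × ℝ) : Set ((M × ℝ) × (M × ℝ)) :=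
  {p | p.1.1 ∈ Λ ∧ p.2.1 ∈ Λ ∧ p.1 ∈ flowLocalUnstable f r δ z₀ ∧ p.2 ∈ flowLocalStable f r δ z₀}

/-- The range of the temporal distance function based at `z₀`. -/
def temporalRange {M : Type*} [EMetricSpace M] (f : M ≃ M) (r : M → ℝ) (Λ : Set M)
    (δ ε : ℝ≥0∞) (z₀ : M × ℝ) : Set ℝ :=
  {T | ∃ p ∈ temporalDomain f r Λ δ z₀, IsTemporalDistance f r Λ ε p.1 p.2 T}

/-- Diophantine real numbers. -/
def IsDiophantine (a : ℝ) : Prop :=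
  ∃ C > (0 : ℝ), ∃ γ > (0 : ℝ), ∀ p q : ℤ, q ≠ 0 → C * |(q : ℝ)| ^ (-γ) ≤ |(q : ℝ) * a - p|

/-- Upper box dimension of a set, `limsup_{η → 0+} log N(η) / log (1/η)`, where `N(η)` is the least
number of closed `η`-balls centred in the set that cover it. -/
def upperBoxDim {X : Type*} [PseudoEMetricSpace X] (A : Set X) : EReal :=
  limsup (fun η : ℝ≥0 => ENNReal.log ((Metric.coveringNumber η A : ℕ∞) : ℝ≥0∞) /
    ((Real.log (1 / (η : ℝ)) : ℝ) : EReal)) (𝓝[>] 0)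

end

/-! ### Integer iterates, stable and unstable sets -/

section Iterates

variable {X : Type*}

/-! Everything happens on `Λ`, a compact perfect totally disconnected space carrying a homeomorphism
`g` with dense periodic points and local product structure. Uniqueness in the product structure
already forces expansiveness.

Let `y` be the local product of `x₁ ∈ W^u_δ(x₀)` and `x₂ ∈ W^s_δ(x₀)`. Each asymptoticity condition
fixes one height, so the temporal distance is the sum over all times `n` of `r(gⁿy) - r(gⁿx₁) -
r(gⁿx₂) + r(gⁿx₀)`. For a roof that is locally constant on `Λ` the terms vanish outside a finite
window (`isTemporalDistance_iff`).

It therefore suffices to find clopen sets `C k`, `k < 4`, which in this window are never visited by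
`x₀`, `x₁`, `x₂`, and are visited at most once in total by `y`, each being visited by some `y`. For
the roof `κ + ∑ c_k 1_{C k}` the sum is then `0` or some `c_k` (`IsMarkerFamily.temporalRange_eq`);
take `c = (α, -α, β, -β)`. Bump functions extend the roof smoothly to `M`.

The sets come from heteroclinic orbits (`exists_isMarkerFamily`). Choose periodic orbits of `a` and
`c k` that avoid a neighbourhood of `x₀`, and corners `x₂`, backward asymptotic to the orbit of `a`,
and `x₁ k`, forward asymptotic to that of `c k`. The fourth corner `y k` runs from the orbit of `a`
to that of `c k` and is near `x₀` only for finitely many times. Let `C k` be the points sharing a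
long symbolic itinerary with `y k`. The backward itineraries of `x₀`, `x₁` and the forward ones of
`x₀`, `x₂` are those of `x₀`, which is asymptotic to neither periodic orbit in the relevant
direction, so a long enough itinerary excludes them. The second claim takes `α = √2`, `β = 1`. -/

theorem Equiv.Perm.zpow_zpow_apply (g : Equiv.Perm X) (m n : ℤ) (x : X) :
    (g ^ m) ((g ^ n) x) = (g ^ (m + n)) x := by
  rw [zpow_add, Equiv.Perm.mul_apply]

theorem Equiv.Perm.zpow_natCast_apply (g : Equiv.Perm X) (n : ℕ) (x : X) :
    (g ^ (n : ℤ)) x = g^[n] x := by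
  rw [zpow_natCast, Equiv.Perm.iterate_eq_pow]

theorem Equiv.Perm.zpow_neg_natCast_apply (g : Equiv.Perm X) (n : ℕ) (x : X) :
    (g ^ (-(n : ℤ))) x = g.symm^[n] x := by
  have h : (g ^ (-(n : ℤ))) = (g.symm : Equiv.Perm X) ^ n := by
    rw [zpow_neg, zpow_natCast, ← inv_pow]; rfl
  rw [h, Equiv.Perm.iterate_eq_pow]

theorem Equiv.Perm.symm_zpow_apply (g : Equiv.Perm X) (n : ℤ) (x : X) :
    ((g.symm : Equiv.Perm X) ^ n) x = (g ^ (-n)) x := by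
  have h : (g.symm : Equiv.Perm X) ^ n = g ^ (-n) := by
    rw [zpow_neg, ← inv_zpow]; rfl
  rw [h]

theorem Equiv.Perm.continuous_zpow [TopologicalSpace X] {g : Equiv.Perm X} (hg : Continuous g)
    (hg' : Continuous g.symm) (n : ℤ) : Continuous (g ^ n) := by
  obtain ⟨m, rfl | rfl⟩ := n.eq_nat_or_neg
  · exact (hg.iterate m).congr fun x => (g.zpow_natCast_apply m x).symm
  · exact (hg'.iterate m).congr fun x => (g.zpow_neg_natCast_apply m x).symm

theorem Equiv.Perm.zpow_mul_period_apply {g : Equiv.Perm X} {x : X} {n : ℕ}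
    (h : Function.IsPeriodicPt g n x) (m : ℤ) : (g ^ (m * n)) x = x := by
  have h1 : (g ^ (n : ℤ)) x = x := by rw [g.zpow_natCast_apply]; exact h
  have h2 : Function.IsFixedPt (g ^ (n : ℤ)) x := h1
  rw [mul_comm, zpow_mul]
  exact Equiv.Perm.zpow_apply_eq_self_of_apply_eq_self h1 m

theorem mem_periodicPts_zpow {g : Equiv.Perm X} {x : X} (h : x ∈ Function.periodicPts g) (n : ℤ) :
    (g ^ n) x ∈ Function.periodicPts g := by
  obtain ⟨m, hm, hx⟩ := h
  refine ⟨m, hm, ?_⟩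
  change g^[m] _ = _
  rw [← g.zpow_natCast_apply, g.zpow_zpow_apply, add_comm, ← g.zpow_zpow_apply,
    g.zpow_natCast_apply, hx]

theorem finite_setOf_sameCycle {g : Equiv.Perm X} {x : X} (h : x ∈ Function.periodicPts g) :
    {y | g.SameCycle x y}.Finite := by
  obtain ⟨m, hm, hx⟩ := h
  refine ((Finset.range m).finite_toSet.image fun i : ℕ => (g ^ (i : ℤ)) x).subset ?_
  rintro y ⟨i, rfl⟩
  have hm' : (m : ℤ) ≠ 0 := by exact_mod_cast hm.ne'
  refine ⟨(i % m).toNat, ?_, ?_⟩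
  · have := Int.emod_lt_of_pos i (by exact_mod_cast hm : (0 : ℤ) < m)
    have := Int.emod_nonneg i hm'
    simp only [Finset.coe_range, mem_Iio]
    lia
  · simp only [Int.toNat_of_nonneg (Int.emod_nonneg i hm')]
    conv_rhs => rw [← Int.emod_add_mul_ediv i m, mul_comm, ← g.zpow_zpow_apply,
      Equiv.Perm.zpow_mul_period_apply hx]

theorem mem_periodicPts_symm {g : Equiv.Perm X} {x : X} (hx : x ∈ Function.periodicPts g) :
    x ∈ Function.periodicPts g.symm := by
  obtain ⟨m, hm, hx⟩ := hx
  refine ⟨m, hm, ?_⟩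
  change g.symm^[m] x = x
  rw [← g.zpow_neg_natCast_apply]
  simpa using Equiv.Perm.zpow_mul_period_apply hx (-1)

variable [PseudoEMetricSpace X] {g : Equiv.Perm X}

theorem mem_stableSet_symm {x y : X} (h : y ∈ stableSet g x) : x ∈ stableSet g y := by
  simpa only [stableSet, mem_ofPred_eq, edist_comm] using h

theorem mem_stableSet_trans {x y z : X} (h : y ∈ stableSet g x) (h' : z ∈ stableSet g y) :
    z ∈ stableSet g x := by
  simp only [stableSet, mem_ofPred_eq] at h h' ⊢
  refine tendsto_of_tendsto_of_tendsto_of_le_of_le tendsto_const_nhds ?_ (fun _ => zero_le)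
    fun n => edist_triangle _ (g^[n] y) _
  simpa using h'.add h

/-- With integer times, invariance under every power of `g` is a mere change of index. -/
theorem mem_stableSet_iff {x y : X} :
    y ∈ stableSet g x ↔ ∀ η > 0, ∃ N : ℤ, ∀ n ≥ N, edist ((g ^ n) y) ((g ^ n) x) ≤ η := by
  simp only [stableSet, mem_ofPred_eq, ENNReal.tendsto_atTop_zero]
  refine forall₂_congr fun η _ => ⟨?_, ?_⟩
  · rintro ⟨N, hN⟩
    refine ⟨N, fun n hn => ?_⟩
    obtain ⟨m, rfl⟩ := Int.eq_ofNat_of_zero_le (show (0 : ℤ) ≤ n by lia)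
    simpa only [g.zpow_natCast_apply] using hN m (by lia)
  · rintro ⟨N, hN⟩
    refine ⟨N.toNat, fun n hn => ?_⟩
    simpa only [g.zpow_natCast_apply] using hN n (by lia)

theorem zpow_mem_stableSet {x y : X} (h : y ∈ stableSet g x) (i : ℤ) :
    (g ^ i) y ∈ stableSet g ((g ^ i) x) := by
  rw [mem_stableSet_iff] at h ⊢
  intro η hη
  obtain ⟨N, hN⟩ := h η hη
  refine ⟨N - i, fun n hn => ?_⟩
  simpa only [g.zpow_zpow_apply] using hN (n + i) (by lia)

theorem mem_unstableSet_iff {x y : X} :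
    y ∈ unstableSet g x ↔ ∀ η > 0, ∃ N : ℤ, ∀ n ≤ N, edist ((g ^ n) y) ((g ^ n) x) ≤ η := by
  rw [unstableSet, mem_stableSet_iff]
  refine forall₂_congr fun η _ => ⟨?_, ?_⟩
  · rintro ⟨N, hN⟩
    refine ⟨-N, fun n hn => ?_⟩
    simpa only [g.symm_zpow_apply, neg_neg] using hN (-n) (by lia)
  · rintro ⟨N, hN⟩
    refine ⟨-N, fun n hn => ?_⟩
    simpa only [g.symm_zpow_apply] using hN (-n) (by lia)

theorem zpow_mem_unstableSet {x y : X} (h : y ∈ unstableSet g x) (i : ℤ) :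
    (g ^ i) y ∈ unstableSet g ((g ^ i) x) := by
  have := zpow_mem_stableSet (g := g.symm) h (-i)
  simp only [g.symm_zpow_apply, neg_neg] at this
  exact this

theorem mem_localStableSet_iff {ε : ℝ≥0∞} {x y : X} :
    y ∈ localStableSet g ε x ↔ ∀ n : ℤ, 0 ≤ n → edist ((g ^ n) y) ((g ^ n) x) ≤ ε := by
  refine ⟨fun h n hn => ?_, fun h n => ?_⟩
  · obtain ⟨m, rfl⟩ := Int.eq_ofNat_of_zero_le hn
    simpa only [g.zpow_natCast_apply] using h m
  · simpa only [g.zpow_natCast_apply] using h n (by lia)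

theorem mem_localUnstableSet_iff {ε : ℝ≥0∞} {x y : X} :
    y ∈ localUnstableSet g ε x ↔ ∀ n : ℤ, n ≤ 0 → edist ((g ^ n) y) ((g ^ n) x) ≤ ε := by
  rw [localUnstableSet, mem_localStableSet_iff]
  refine ⟨fun h n hn => ?_, fun h n hn => ?_⟩
  · simpa only [g.symm_zpow_apply, neg_neg] using h (-n) (by lia)
  · simpa only [g.symm_zpow_apply] using h (-n) (by lia)

theorem localStableSet_mono {ε ε' : ℝ≥0∞} (h : ε ≤ ε') (x : X) :
    localStableSet g ε x ⊆ localStableSet g ε' x := fun _ hy n => (hy n).trans h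

theorem localUnstableSet_mono {ε ε' : ℝ≥0∞} (h : ε ≤ ε') (x : X) :
    localUnstableSet g ε x ⊆ localUnstableSet g ε' x := fun _ hy n => (hy n).trans h

theorem self_mem_localStableSet (ε : ℝ≥0∞) (x : X) : x ∈ localStableSet g ε x := fun n => by simp

theorem self_mem_localUnstableSet (ε : ℝ≥0∞) (x : X) : x ∈ localUnstableSet g ε x :=
  fun n => by simp

end Iterates

/-! ### Expansiveness, periodic points and symbolic labels on a compact space -/

section Expansive

variable {X : Type*} [EMetricSpace X] {g : Equiv.Perm X}

/-- At multiples of a common period both points return, so their distance is among the terms tending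
to `0`. -/
theorem eq_of_mem_stableSet_of_periodic {x y : X} (hx : x ∈ Function.periodicPts g)
    (hy : y ∈ Function.periodicPts g) (h : y ∈ stableSet g x) : y = x := by
  obtain ⟨m, hm, hx⟩ := hx
  obtain ⟨n, hn, hy⟩ := hy
  rw [mem_stableSet_iff] at h
  rw [← edist_le_zero]
  refine le_of_forall_gt_imp_ge_of_dense fun η hη => ?_
  obtain ⟨N, hN⟩ := h η hη
  have hmn : (0 : ℤ) < m * n := by positivity
  have key := hN (|N| * (m * n)) (by nlinarith [le_abs_self N, abs_nonneg N])
  have e1 : (g ^ (|N| * (m * n))) x = x := by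
    rw [show |N| * ((m : ℤ) * n) = (|N| * n) * m by ring, Equiv.Perm.zpow_mul_period_apply hx]
  have e2 : (g ^ (|N| * (m * n))) y = y := by
    rw [show |N| * ((m : ℤ) * n) = (|N| * m) * n by ring, Equiv.Perm.zpow_mul_period_apply hy]
  rwa [e1, e2] at key

theorem eq_of_mem_unstableSet_of_periodic {x y : X} (hx : x ∈ Function.periodicPts g)
    (hy : y ∈ Function.periodicPts g) (h : y ∈ unstableSet g x) : y = x :=
  eq_of_mem_stableSet_of_periodic (mem_periodicPts_symm hx) (mem_periodicPts_symm hy) h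

/-- `ε₀` is an expansivity constant of `g`. -/
def IsExpansive (g : Equiv.Perm X) (ε₀ : ℝ≥0∞) : Prop :=
  ∀ x y : X, (∀ n : ℤ, edist ((g ^ n) x) ((g ^ n) y) ≤ ε₀) → x = y

theorem IsExpansive.symm {ε₀ : ℝ≥0∞} (h : IsExpansive g ε₀) : IsExpansive g.symm ε₀ :=
  fun x y hxy => h x y fun n => by simpa only [g.symm_zpow_apply, neg_neg] using hxy (-n)

variable [CompactSpace X]

/-- Compactness makes expansiveness uniform: otherwise the nested closed sets of pairs at distance
at least `η` that stay `ε₀`-close on longer and longer windows would have a common point. -/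
theorem IsExpansive.exists_edist_lt {ε₀ : ℝ≥0∞} (h : IsExpansive g ε₀) (hg : Continuous g)
    (hg' : Continuous g.symm) {η : ℝ≥0∞} (hη : 0 < η) :
    ∃ N : ℕ, ∀ x y : X, (∀ n : ℤ, |n| ≤ N → edist ((g ^ n) x) ((g ^ n) y) ≤ ε₀) →
      edist x y < η := by
  by_contra! hcon
  let E : ℕ → Set (X × X) := fun N =>
    {p | (∀ n : ℤ, |n| ≤ N → edist ((g ^ n) p.1) ((g ^ n) p.2) ≤ ε₀) ∧ η ≤ edist p.1 p.2}
  have hcl : ∀ N, IsClosed (E N) := fun N => by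
    have hN : IsClosed (⋂ n : ℤ, ⋂ _ : |n| ≤ N,
        {p : X × X | edist ((g ^ n) p.1) ((g ^ n) p.2) ≤ ε₀}) :=
      isClosed_iInter fun n => isClosed_iInter fun _ => isClosed_le
        (((Equiv.Perm.continuous_zpow hg hg' n).comp continuous_fst).edist
          ((Equiv.Perm.continuous_zpow hg hg' n).comp continuous_snd)) continuous_const
    convert hN.inter (isClosed_le (continuous_const (y := η))
      (continuous_fst.edist continuous_snd (α := X))) using 1
    ext p
    simp [E]
  obtain ⟨p, hp⟩ := IsCompact.nonempty_iInter_of_sequence_nonempty_isCompact_isClosed E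
    (fun N p hp => ⟨fun n hn => hp.1 n (by push_cast; lia), hp.2⟩)
    (fun N => let ⟨x, y, hxy, hle⟩ := hcon N; ⟨(x, y), hxy, hle⟩) (hcl 0).isCompact hcl
  rw [mem_iInter] at hp
  have heq : p.1 = p.2 := h _ _ fun n => (hp n.natAbs).1 n (by simp)
  have := (hp 0).2
  rw [heq, edist_self] at this
  exact absurd this (not_le.2 hη)

/-- Local stable sets of size at most the expansivity constant are uniformly contracted. -/
theorem IsExpansive.exists_contraction {ε₀ : ℝ≥0∞} (h : IsExpansive g ε₀) (hg : Continuous g)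
    (hg' : Continuous g.symm) {η : ℝ≥0∞} (hη : 0 < η) :
    ∃ N : ℕ, ∀ x, ∀ y ∈ localStableSet g ε₀ x, ∀ n : ℤ, N ≤ n →
      edist ((g ^ n) y) ((g ^ n) x) ≤ η := by
  obtain ⟨N, hN⟩ := h.exists_edist_lt hg hg' hη
  -- A window of radius `N` about a time `n ≥ N` lies in the nonnegative times, where the orbits are
  -- `ε₀`-close.
  refine ⟨N, fun x y hy n hn => (hN _ _ fun m hm => ?_).le⟩
  rw [mem_localStableSet_iff] at hy
  rw [g.zpow_zpow_apply, g.zpow_zpow_apply]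
  exact hy _ (by have := neg_abs_le m; lia)

theorem IsExpansive.exists_contraction_unstable {ε₀ : ℝ≥0∞} (h : IsExpansive g ε₀)
    (hg : Continuous g) (hg' : Continuous g.symm) {η : ℝ≥0∞} (hη : 0 < η) :
    ∃ N : ℕ, ∀ x, ∀ y ∈ localUnstableSet g ε₀ x, ∀ n : ℤ, n ≤ -N →
      edist ((g ^ n) y) ((g ^ n) x) ≤ η := by
  obtain ⟨N, hN⟩ := h.symm.exists_contraction hg' hg hη
  refine ⟨N, fun x y hy n hn => ?_⟩
  simpa only [g.symm_zpow_apply, neg_neg] using hN x y hy (-n) (by lia)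

theorem IsExpansive.localStableSet_subset {ε₀ : ℝ≥0∞} (h : IsExpansive g ε₀) (hg : Continuous g)
    (hg' : Continuous g.symm) (x : X) : localStableSet g ε₀ x ⊆ stableSet g x := by
  intro y hy
  rw [mem_stableSet_iff]
  intro η hη
  obtain ⟨N, hN⟩ := h.exists_contraction hg hg' hη
  exact ⟨N, hN x y hy⟩

theorem IsExpansive.localUnstableSet_subset {ε₀ : ℝ≥0∞} (h : IsExpansive g ε₀)
    (hg : Continuous g) (hg' : Continuous g.symm) (x : X) :
    localUnstableSet g ε₀ x ⊆ unstableSet g x :=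
  h.symm.localStableSet_subset hg' hg x

/-- Finitely many periodic points with distinct orbits near a prescribed point `x`, all of whose
orbits stay away from a prescribed point `x₀`, uniformly in `x₀` and `x`. -/
theorem exists_periodic_avoiding [PerfectSpace X]
    (hper : Dense (Function.periodicPts g)) (m : ℕ) {η : ℝ≥0∞} (hη : 0 < η) :
    ∃ ρ > (0 : ℝ≥0∞), ∀ x₀ x : X, ∃ c : Fin m → X, (∀ k, c k ∈ Function.periodicPts g) ∧
      (∀ k l, k ≠ l → ¬ g.SameCycle (c k) (c l)) ∧ (∀ k, edist (c k) x ≤ η) ∧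
      ∀ k (i : ℤ), ρ < edist ((g ^ i) (c k)) x₀ := by
  have hpoint : ∀ (F : Set X), F.Finite → ∀ x : X, ∃ p ∈ Function.periodicPts g,
      p ∉ F ∧ edist p x < η / 2 := by
    intro F hF x
    have hU : (Metric.eball x (η / 2) \ F).Nonempty := by
      have h1 : Metric.eball x (η / 2) ∈ 𝓝 x := Metric.eball_mem_nhds x (ENNReal.half_pos hη.ne')
      have h2 : (Metric.eball x (η / 2)).Infinite := infinite_of_mem_nhds x h1
      exact (h2.sdiff hF).nonempty
    obtain ⟨p, hp, hp'⟩ := hper.inter_open_nonempty _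
      (Metric.isOpen_eball.sdiff hF.isClosed) hU
    exact ⟨p, hp', hp.2, hp.1⟩
  have hfamily : ∀ x₀ x : X, ∀ n : ℕ, ∃ c : Fin n → X, (∀ k, c k ∈ Function.periodicPts g) ∧
      (∀ k l, k ≠ l → ¬ g.SameCycle (c k) (c l)) ∧ (∀ k, edist (c k) x < η / 2) ∧
      ∀ k, ¬ g.SameCycle (c k) x₀ := by
    intro x₀ x n
    induction n with
    | zero => exact ⟨Fin.elim0, fun k => k.elim0, fun k => k.elim0, fun k => k.elim0,
        fun k => k.elim0⟩
    | succ n ih =>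
      obtain ⟨c, h1, h2, h3, h4⟩ := ih
      -- The orbits to avoid are finite; that of `x₀` is removed only when `x₀` is periodic.
      have hF : ((⋃ k, {y | g.SameCycle (c k) y}) ∪
          {y | x₀ ∈ Function.periodicPts g ∧ g.SameCycle x₀ y}).Finite := by
        refine (finite_iUnion fun k => finite_setOf_sameCycle (h1 k)).union ?_
        by_cases hx : x₀ ∈ Function.periodicPts g
        · simpa [hx] using finite_setOf_sameCycle hx
        · simp [hx]
      obtain ⟨p, hp, hpF, hpx⟩ := hpoint _ hF x
      simp only [mem_union, mem_iUnion, mem_ofPred_eq, not_or, not_exists, not_and] at hpF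
      refine ⟨Fin.snoc c p, ?_, ?_, ?_, ?_⟩
      · intro k
        refine Fin.lastCases ?_ (fun k => ?_) k <;> simp [hp, h1]
      · intro k l
        refine Fin.lastCases ?_ (fun k => ?_) k <;> refine Fin.lastCases ?_ (fun l => ?_) l
        · simp
        · intro _
          simpa using fun h => hpF.1 l h.symm
        · intro _
          simpa using hpF.1 k
        · intro hkl
          simpa using h2 k l (by rintro rfl; exact hkl rfl)
      · intro k
        refine Fin.lastCases ?_ (fun k => ?_) k <;> simp [hpx, h3]
      · intro k
        refine Fin.lastCases ?_ (fun k => ?_) k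
        · simp only [Fin.snoc_last]
          intro h
          obtain ⟨i, rfl⟩ := h
          exact hpF.2 (mem_periodicPts_zpow hp i) ⟨-i, by simp⟩
        · simpa using h4 k
  -- A family chosen for one pair still works for nearby pairs after halving the constants, so
  -- compactness of `X × X` makes `ρ` uniform.
  have main : ∃ ρ > (0 : ℝ≥0∞), ∀ q : X × X, q ∈ (univ : Set (X × X)) → ∃ c : Fin m → X,
      (∀ k, c k ∈ Function.periodicPts g) ∧
      (∀ k l, k ≠ l → ¬ g.SameCycle (c k) (c l)) ∧ (∀ k, edist (c k) q.2 ≤ η) ∧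
      ∀ k (i : ℤ), ρ < edist ((g ^ i) (c k)) q.1 := by
    refine isCompact_univ.induction_on (p := fun s => ∃ ρ > (0 : ℝ≥0∞), ∀ q : X × X, q ∈ s →
      ∃ c : Fin m → X, (∀ k, c k ∈ Function.periodicPts g) ∧
      (∀ k l, k ≠ l → ¬ g.SameCycle (c k) (c l)) ∧ (∀ k, edist (c k) q.2 ≤ η) ∧
      ∀ k (i : ℤ), ρ < edist ((g ^ i) (c k)) q.1) ⟨1, one_pos, by simp⟩ ?_ ?_ ?_
    · rintro s t hst ⟨ρ, hρ, h⟩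
      exact ⟨ρ, hρ, fun q hq => h q (hst hq)⟩
    · rintro s t ⟨ρ, hρ, h⟩ ⟨ρ', hρ', h'⟩
      refine ⟨min ρ ρ', lt_min hρ hρ', ?_⟩
      rintro q (hq | hq)
      · obtain ⟨c, h1, h2, h3, h4⟩ := h q hq
        exact ⟨c, h1, h2, h3, fun k i => (min_le_left _ _).trans_lt (h4 k i)⟩
      · obtain ⟨c, h1, h2, h3, h4⟩ := h' q hq
        exact ⟨c, h1, h2, h3, fun k i => (min_le_right _ _).trans_lt (h4 k i)⟩
    · rintro ⟨x₀, x⟩ -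
      obtain ⟨c, h1, h2, h3, h4⟩ := hfamily x₀ x m
      have hF : (⋃ k, {y | g.SameCycle (c k) y}).Finite :=
        finite_iUnion fun k => finite_setOf_sameCycle (h1 k)
      have hx₀ : x₀ ∉ ⋃ k, {y | g.SameCycle (c k) y} := by simpa using h4
      obtain ⟨σ, hσ, hball⟩ := EMetric.mem_nhds_iff.1 (hF.isClosed.isOpen_compl.mem_nhds hx₀)
      have hσ2 : 0 < σ / 2 := ENNReal.half_pos hσ.ne'
      refine ⟨_, mem_nhdsWithin_of_mem_nhds (prod_mem_nhds
        (Metric.eball_mem_nhds x₀ (lt_min hσ2 one_pos))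
        (Metric.eball_mem_nhds x (ENNReal.half_pos hη.ne'))), min (σ / 2) 1,
        lt_min hσ2 one_pos, ?_⟩
      rintro ⟨z₀, z⟩ ⟨hz₀, hz⟩
      refine ⟨c, h1, h2, fun k => ?_, fun k i => ?_⟩
      · calc edist (c k) z ≤ edist (c k) x + edist x z := edist_triangle _ _ _
          _ ≤ η / 2 + η / 2 := add_le_add (h3 k).le (by rw [edist_comm]; exact hz.le)
          _ = η := ENNReal.add_halves η
      · by_contra! hle
        have hlt : edist ((g ^ i) (c k)) x₀ < σ := by
          calc edist ((g ^ i) (c k)) x₀ ≤ edist ((g ^ i) (c k)) z₀ + edist z₀ x₀ :=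
                edist_triangle _ _ _
            _ < min (σ / 2) 1 + min (σ / 2) 1 :=
                ENNReal.add_lt_add_of_le_of_lt
                  (ne_top_of_le_ne_top ENNReal.one_ne_top (hle.trans (min_le_right _ _))) hle hz₀
            _ ≤ σ / 2 + σ / 2 := add_le_add (min_le_left _ _) (min_le_left _ _)
            _ = σ := ENNReal.add_halves σ
        exact hball (show (g ^ i) (c k) ∈ Metric.eball x₀ σ from hlt)
          (mem_iUnion.2 ⟨k, i, rfl⟩)
  obtain ⟨ρ, hρ, h⟩ := main
  exact ⟨ρ, hρ, fun x₀ x => h (x₀, x) (mem_univ _)⟩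

/-- A compact totally disconnected space has locally constant labellings of arbitrarily small
mesh. -/
theorem exists_isLocallyConstant_edist_le [TotallyDisconnectedSpace X] {ρ : ℝ≥0∞} (hρ : 0 < ρ) :
    ∃ L : X → Set X, IsLocallyConstant L ∧ ∀ x y, L x = L y → edist x y ≤ ρ := by
  have hV : ∀ x : X, ∃ V : Set X, IsClopen V ∧ x ∈ V ∧ V ⊆ Metric.eball x (ρ / 2) := fun x =>
    compact_exists_isClopen_in_isOpen Metric.isOpen_eball
      (Metric.mem_eball_self (ENNReal.half_pos hρ.ne'))
  choose V hV hxV hVb using hV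
  obtain ⟨t, ht⟩ := isCompact_univ.elim_finite_subcover V (fun x => (hV x).2)
    fun x _ => mem_iUnion.2 ⟨x, hxV x⟩
  -- The label records which members of a finite clopen cover contain the point, so points with
  -- equal labels share a member.
  refine ⟨fun z => {x | x ∈ t ∧ z ∈ V x}, ?_, fun z w hzw => ?_⟩
  · rw [IsLocallyConstant.iff_eventually_eq]
    intro z
    have : ∀ x ∈ t, ∀ᶠ w in 𝓝 z, (w ∈ V x ↔ z ∈ V x) := by
      intro x _
      by_cases hz : z ∈ V x
      · filter_upwards [(hV x).2.mem_nhds hz] with w hw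
        simp [hw, hz]
      · filter_upwards [(hV x).1.isOpen_compl.mem_nhds hz] with w hw
        simpa [hz] using hw
    filter_upwards [(eventually_all_finset t).2 this] with w hw
    ext x
    simp only [mem_ofPred_eq]
    exact and_congr_right fun hx => hw x hx
  · obtain ⟨x, hx⟩ := mem_iUnion.1 (ht (mem_univ z))
    obtain ⟨hxt, hzx⟩ := mem_iUnion.1 hx
    have hwx : w ∈ V x := by
      have : x ∈ {x | x ∈ t ∧ w ∈ V x} := by
        rw [← show {x | x ∈ t ∧ z ∈ V x} = {x | x ∈ t ∧ w ∈ V x} from hzw]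
        exact ⟨hxt, hzx⟩
      exact this.2
    calc edist z w ≤ edist z x + edist w x := edist_triangle_right _ _ _
      _ ≤ ρ / 2 + ρ / 2 := add_le_add (hVb x hzx).le (hVb x hwx).le
      _ = ρ := ENNReal.add_halves ρ

theorem IsLocallyConstant.exists_eq_of_edist_le {Y : Type*} {L : X → Y}
    (hL : IsLocallyConstant L) :
    ∃ r > (0 : ℝ≥0∞), ∀ x y, edist x y ≤ r → L x = L y := by
  obtain ⟨r, hr, h⟩ := lebesgue_number_lemma_of_emetric (isCompact_univ (X := X))
    (c := fun z : Y => L ⁻¹' {z}) (fun z => hL _) (fun x _ => mem_iUnion.2 ⟨L x, rfl⟩)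
  have hr' : 0 < min r 1 := lt_min hr one_pos
  refine ⟨min r 1 / 2, ENNReal.half_pos hr'.ne', fun x y hxy => ?_⟩
  obtain ⟨z, hz⟩ := h x (mem_univ x)
  have h1 : L x = z := hz (Metric.mem_eball_self hr)
  have h2 : L y = z := hz (show y ∈ Metric.eball x r by
    rw [Metric.mem_eball, edist_comm]
    exact hxy.trans_lt ((ENNReal.half_lt_self hr'.ne'
      (ne_top_of_le_ne_top ENNReal.one_ne_top (min_le_right _ _))).trans_le (min_le_left _ _)))
  rw [h1, h2]

end Expansive

/-! ### Marker families from heteroclinic orbits -/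

section Markers

variable {X : Type*} [EMetricSpace X]

/-- Local product structure at scale `ε`, for points at distance at most `δ`. -/
def HasLocalProduct (g : Equiv.Perm X) (ε δ : ℝ≥0∞) : Prop :=
  ∀ x y, edist x y ≤ δ → ∃ z, localStableSet g ε x ∩ localUnstableSet g ε y = {z}

/-- If the full orbits stay `ε`-close, both points lie in the singleton `W^s_ε(y) ∩ W^u_ε(y)`. -/
theorem HasLocalProduct.isExpansive {g : Equiv.Perm X} {ε δ : ℝ≥0∞}
    (h : HasLocalProduct g ε δ) : IsExpansive g ε := by
  intro x y hxy
  obtain ⟨z, hz⟩ := h y y (by simp)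
  have hx : x ∈ localStableSet g ε y ∩ localUnstableSet g ε y :=
    ⟨mem_localStableSet_iff.2 fun n _ => hxy n, mem_localUnstableSet_iff.2 fun n _ => hxy n⟩
  have hy : y ∈ localStableSet g ε y ∩ localUnstableSet g ε y :=
    ⟨self_mem_localStableSet _ _, self_mem_localUnstableSet _ _⟩
  rw [hz] at hx hy
  exact hx.trans hy.symm

/-- `y` closes up the quadrilateral with corners `x₀`, `x₁`, `x₂`:
`x₁ ∈ W^u_δ(x₀)`, `x₂ ∈ W^s_δ(x₀)` and `y ∈ W^s_ε(x₁) ∩ W^u_ε(x₂)`. -/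
structure IsQuadrilateral (g : Equiv.Perm X) (δ ε : ℝ≥0∞) (x₀ x₁ x₂ y : X) : Prop where
  left : x₁ ∈ localUnstableSet g δ x₀
  right : x₂ ∈ localStableSet g δ x₀
  stable : y ∈ localStableSet g ε x₁
  unstable : y ∈ localUnstableSet g ε x₂

/-- A finite family of disjoint clopen sets such that, for each quadrilateral at `x₀`, within a
time window outside of which the visits to the sets cancel out, only the fourth corner may visit
the sets, and it does so at most once; each of the sets is visited by some quadrilateral. -/
structure IsMarkerFamily {ι : Type*} (g : Equiv.Perm X) (δ ε : ℝ≥0∞) (x₀ : X) (C : ι → Set X)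
    (K : ℤ) : Prop where
  isClopen : ∀ k, IsClopen (C k)
  exists_unique : ∀ x₁ ∈ localUnstableSet g δ x₀, ∀ x₂ ∈ localStableSet g δ x₀,
    ∃! y, y ∈ localStableSet g ε x₁ ∩ localUnstableSet g ε x₂
  asymptotic : ∀ x₁ x₂ y, IsQuadrilateral g δ ε x₀ x₁ x₂ y →
    x₁ ∈ unstableSet g x₀ ∧ x₂ ∈ stableSet g x₀ ∧ y ∈ stableSet g x₁ ∧ y ∈ unstableSet g x₂
  forward : ∀ x₁ x₂ y, IsQuadrilateral g δ ε x₀ x₁ x₂ y → ∀ n : ℤ, K ≤ n → ∀ k,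
    ((g ^ n) y ∈ C k ↔ (g ^ n) x₁ ∈ C k) ∧ ((g ^ n) x₂ ∈ C k ↔ (g ^ n) x₀ ∈ C k)
  backward : ∀ x₁ x₂ y, IsQuadrilateral g δ ε x₀ x₁ x₂ y → ∀ n : ℤ, n ≤ -K → ∀ k,
    ((g ^ n) y ∈ C k ↔ (g ^ n) x₂ ∈ C k) ∧ ((g ^ n) x₁ ∈ C k ↔ (g ^ n) x₀ ∈ C k)
  no_visit : ∀ x₁ x₂ y, IsQuadrilateral g δ ε x₀ x₁ x₂ y → ∀ n : ℤ, |n| ≤ K → ∀ k,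
    (g ^ n) x₀ ∉ C k ∧ (g ^ n) x₁ ∉ C k ∧ (g ^ n) x₂ ∉ C k
  visit_unique : ∀ x₁ x₂ y, IsQuadrilateral g δ ε x₀ x₁ x₂ y → ∀ n m : ℤ, |n| ≤ K → |m| ≤ K →
    ∀ k l, (g ^ n) y ∈ C k → (g ^ m) y ∈ C l → n = m ∧ k = l
  exists_visit : ∀ k, ∃ x₁ x₂ y, IsQuadrilateral g δ ε x₀ x₁ x₂ y ∧ y ∈ C k
  nonneg : 0 ≤ K

theorem isClopen_cylinder {g : Equiv.Perm X} (hg : Continuous g) (hg' : Continuous g.symm)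
    {L : X → Set X} (hL : IsLocallyConstant L) (y : X) (s : Finset ℤ) :
    IsClopen {z | ∀ j ∈ s, L ((g ^ j) z) = L ((g ^ j) y)} := by
  have h : {z | ∀ j ∈ s, L ((g ^ j) z) = L ((g ^ j) y)} =
      ⋂ j ∈ s, (fun z => L ((g ^ j) z)) ⁻¹' {L ((g ^ j) y)} := by
    ext z; simp
  rw [h]
  exact s.finite_toSet.isClopen_biInter fun j _ =>
    (hL.comp_continuous (Equiv.Perm.continuous_zpow hg hg' j)).isClopen_fiber _

/-- Six candidate periodic orbits leave four usable ones, since each of the two obstructions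
excludes at most one. -/
theorem exists_fin_four_embedding_avoiding {P Q : Fin 6 → Prop}
    (hP : ∀ k l, P k → P l → k = l) (hQ : ∀ k l, Q k → Q l → k = l) :
    ∃ e : Fin 4 ↪ Fin 6, ∀ k, ¬ P (e k) ∧ ¬ Q (e k) := by
  classical
  have h1 : (Finset.univ.filter P).card ≤ 1 := Finset.card_le_one.2 fun k hk l hl =>
    hP k l (Finset.mem_filter.1 hk).2 (Finset.mem_filter.1 hl).2
  have h2 : (Finset.univ.filter Q).card ≤ 1 := Finset.card_le_one.2 fun k hk l hl =>
    hQ k l (Finset.mem_filter.1 hk).2 (Finset.mem_filter.1 hl).2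
  have h3 : Fintype.card (Fin 4) ≤ Fintype.card {k : Fin 6 // ¬ P k ∧ ¬ Q k} := by
    have h4 : (Finset.univ.filter fun k : Fin 6 => ¬ (¬ P k ∧ ¬ Q k)).card ≤ 2 := by
      refine (Finset.card_le_card (t := Finset.univ.filter P ∪ Finset.univ.filter Q) ?_).trans
        ((Finset.card_union_le _ _).trans (by lia))
      intro k
      simp only [Finset.mem_filter, Finset.mem_univ, true_and, Finset.mem_union]
      tauto
    have h5 := Finset.card_filter_add_card_filter_not (s := (Finset.univ : Finset (Fin 6)))
      (fun k => ¬ P k ∧ ¬ Q k)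
    rw [Fintype.card_subtype]
    simp only [Finset.card_univ, Fintype.card_fin] at h5 ⊢
    lia
  obtain ⟨e⟩ := Function.Embedding.nonempty_of_card_le h3
  exact ⟨e.trans (Function.Embedding.subtype _), fun k => (e k).2⟩

/-- The markers are itinerary cylinders around four heteroclinic points. All scales are fixed before
`x₀`, so that `δ₁` does not depend on it; the periodic points, the cylinders and `K` may depend on
`x₀` and `δ`. -/
theorem exists_isMarkerFamily [CompactSpace X] [TotallyDisconnectedSpace X] [PerfectSpace X]
    {g : Equiv.Perm X} (hg : Continuous g) (hg' : Continuous g.symm)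
    (hper : Dense (Function.periodicPts g)) {ε₀ : ℝ≥0∞} (hε₀ : 0 < ε₀)
    (hlp : ∀ ε : ℝ≥0∞, 0 < ε → ε ≤ ε₀ → ∃ δ > (0 : ℝ≥0∞), HasLocalProduct g ε δ)
    {ε : ℝ≥0∞} (hε : 0 < ε) (hεε₀ : ε ≤ ε₀) :
    ∃ δ₁ > (0 : ℝ≥0∞), ∀ δ : ℝ≥0∞, 0 < δ → δ ≤ δ₁ → ∀ x₀ : X,
      ∃ (C : Fin 4 → Set X) (K : ℤ), IsMarkerFamily g δ ε x₀ C K := by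
  obtain ⟨_, _, hlp₀⟩ := hlp ε₀ hε₀ le_rfl
  have hexp : IsExpansive g ε₀ := hlp₀.isExpansive
  obtain ⟨δε, hδε, hlpε⟩ := hlp ε hε hεε₀
  obtain ⟨ρ, hρ, hav⟩ := exists_periodic_avoiding hper 6 hδε
  -- Mesh `ρ` separates the label of `x₀` from those on the chosen periodic orbits; mesh `ε₀` makes
  -- a full itinerary determine its point.
  obtain ⟨L, hL, hmesh⟩ := exists_isLocallyConstant_edist_le (X := X) (lt_min hρ hε₀)
  obtain ⟨r, hr, hLr⟩ := hL.exists_eq_of_edist_le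
  set μ := min r ε with hμ_def
  have hμ : 0 < μ := lt_min hr hε
  obtain ⟨δμ, hδμ, hlpμ⟩ := hlp μ hμ ((min_le_right _ _).trans hεε₀)
  refine ⟨min (min r ε) (min (δε / 2) (δμ / 2)), lt_min hμ
    (lt_min (ENNReal.half_pos hδε.ne') (ENNReal.half_pos hδμ.ne')), fun δ hδ hδ₁ x₀ => ?_⟩
  have hδr : δ ≤ r := hδ₁.trans ((min_le_left _ _).trans (min_le_left _ _))
  have hδε₀ : δ ≤ ε₀ :=
    (hδ₁.trans ((min_le_left _ _).trans (min_le_right _ _))).trans hεε₀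
  have hdist : ∀ x₁ ∈ localUnstableSet g δ x₀, ∀ x₂ ∈ localStableSet g δ x₀,
      edist x₁ x₂ ≤ δε ∧ edist x₁ x₂ ≤ δμ := by
    intro x₁ h₁ x₂ h₂
    have h₁' : edist x₁ x₀ ≤ δ := h₁ 0
    have h₂' : edist x₂ x₀ ≤ δ := h₂ 0
    have h := (edist_triangle_right x₁ x₂ x₀).trans (add_le_add h₁' h₂')
    constructor
    · refine h.trans ((add_le_add ?_ ?_).trans_eq (ENNReal.add_halves δε)) <;>
      exact hδ₁.trans ((min_le_right _ _).trans (min_le_left _ _))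
    · refine h.trans ((add_le_add ?_ ?_).trans_eq (ENNReal.add_halves δμ)) <;>
      exact hδ₁.trans ((min_le_right _ _).trans (min_le_right _ _))
  have hunique : ∀ x₁ ∈ localUnstableSet g δ x₀, ∀ x₂ ∈ localStableSet g δ x₀,
      ∃! y, y ∈ localStableSet g ε x₁ ∩ localUnstableSet g ε x₂ := by
    intro x₁ h₁ x₂ h₂
    obtain ⟨y, hy⟩ := hlpε x₁ x₂ (hdist x₁ h₁ x₂ h₂).1
    exact ⟨y, by simp only [hy, mem_singleton_iff], fun z hz => by
      simpa only [hy, mem_singleton_iff] using hz⟩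
  -- The product point at the smaller scale `μ` is also one at scale `ε`, hence equals `y` by
  -- uniqueness. As `μ ≤ r`, labels along `y` then agree with those of `x₁` forward and `x₂`
  -- backward.
  have hclose : ∀ x₁ x₂ y, IsQuadrilateral g δ ε x₀ x₁ x₂ y →
      y ∈ localStableSet g μ x₁ ∧ y ∈ localUnstableSet g μ x₂ := by
    intro x₁ x₂ y h
    obtain ⟨z, hz⟩ := hlpμ x₁ x₂ (hdist x₁ h.left x₂ h.right).2
    have hz' : z ∈ localStableSet g μ x₁ ∩ localUnstableSet g μ x₂ := by simp [hz]
    have hyz : y = z := (hunique x₁ h.left x₂ h.right).unique ⟨h.stable, h.unstable⟩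
      ⟨localStableSet_mono (min_le_right _ _) _ hz'.1,
        localUnstableSet_mono (min_le_right _ _) _ hz'.2⟩
    rwa [hyz]
  have hlabS : ∀ {η x y}, η ≤ r → y ∈ localStableSet g η x → ∀ n : ℤ, 0 ≤ n →
      L ((g ^ n) y) = L ((g ^ n) x) := fun hη hy n hn =>
    hLr _ _ ((mem_localStableSet_iff.1 hy n hn).trans hη)
  have hlabU : ∀ {η x y}, η ≤ r → y ∈ localUnstableSet g η x → ∀ n : ℤ, n ≤ 0 →
      L ((g ^ n) y) = L ((g ^ n) x) := fun hη hy n hn =>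
    hLr _ _ ((mem_localUnstableSet_iff.1 hy n hn).trans hη)
  have hμr : μ ≤ r := min_le_left _ _
  -- labels along a quadrilateral
  have lab1 : ∀ x₁ x₂ y, IsQuadrilateral g δ ε x₀ x₁ x₂ y → ∀ n : ℤ, 0 ≤ n →
      L ((g ^ n) y) = L ((g ^ n) x₁) := fun x₁ x₂ y h => hlabS hμr (hclose x₁ x₂ y h).1
  have lab2 : ∀ x₁ x₂ y, IsQuadrilateral g δ ε x₀ x₁ x₂ y → ∀ n : ℤ, n ≤ 0 →
      L ((g ^ n) y) = L ((g ^ n) x₂) := fun x₁ x₂ y h => hlabU hμr (hclose x₁ x₂ y h).2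
  have lab3 : ∀ x₁ x₂ y, IsQuadrilateral g δ ε x₀ x₁ x₂ y → ∀ n : ℤ, n ≤ 0 →
      L ((g ^ n) x₁) = L ((g ^ n) x₀) := fun x₁ x₂ y h => hlabU hδr h.left
  have lab4 : ∀ x₁ x₂ y, IsQuadrilateral g δ ε x₀ x₁ x₂ y → ∀ n : ℤ, 0 ≤ n →
      L ((g ^ n) x₂) = L ((g ^ n) x₀) := fun x₁ x₂ y h => hlabS hδr h.right
  have hasym : ∀ x₁ x₂ y, IsQuadrilateral g δ ε x₀ x₁ x₂ y →
      x₁ ∈ unstableSet g x₀ ∧ x₂ ∈ stableSet g x₀ ∧ y ∈ stableSet g x₁ ∧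
        y ∈ unstableSet g x₂ := fun x₁ x₂ y h =>
    ⟨hexp.localUnstableSet_subset hg hg' _ (localUnstableSet_mono hδε₀ _ h.left),
      hexp.localStableSet_subset hg hg' _ (localStableSet_mono hδε₀ _ h.right),
      hexp.localStableSet_subset hg hg' _ (localStableSet_mono hεε₀ _ h.stable),
      hexp.localUnstableSet_subset hg hg' _ (localUnstableSet_mono hεε₀ _ h.unstable)⟩
  obtain ⟨J, a, c, ha, hc, hcc, hac, haρ, hcρ, hax₀, hcx₀, x₂', x₁', hx₂', hx₁', hx₂a, hx₁c⟩ :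
      ∃ (J : ℤ) (a : X) (c : Fin 4 → X), a ∈ Function.periodicPts g ∧
        (∀ k, c k ∈ Function.periodicPts g) ∧ (∀ k l, k ≠ l → ¬ g.SameCycle (c k) (c l)) ∧
        (∀ k, ¬ g.SameCycle (c k) a) ∧ (∀ i : ℤ, ρ < edist ((g ^ i) a) x₀) ∧
        (∀ k (i : ℤ), ρ < edist ((g ^ i) (c k)) x₀) ∧
        (∀ i : ℤ, x₀ ∉ unstableSet g ((g ^ i) a)) ∧
        (∀ k (i : ℤ), x₀ ∉ stableSet g ((g ^ i) (c k))) ∧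
        ∃ (x₂ : X) (x₁ : Fin 4 → X), x₂ ∈ localStableSet g δ x₀ ∧
          (∀ k, x₁ k ∈ localUnstableSet g δ x₀) ∧
          x₂ ∈ unstableSet g ((g ^ J) a) ∧ ∀ k, x₁ k ∈ stableSet g ((g ^ (-J)) (c k)) := by
    obtain ⟨N₁, hN₁⟩ := hexp.exists_contraction hg hg' hδ
    obtain ⟨N₂, hN₂⟩ := hexp.exists_contraction_unstable hg hg' hδ
    -- After `J` iterates local stable sets of size `ε` have shrunk to size `δ`. So `a` is taken
    -- near `g^(-J) x₀` and the `c k` near `g^J x₀`, and the product points are carried back to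
    -- `x₀`.
    set J : ℤ := max N₁ N₂
    have hJ₁ : (N₁ : ℤ) ≤ J := le_max_left _ _
    have hJ₂ : (N₂ : ℤ) ≤ J := le_max_right _ _
    obtain ⟨a, ha, haa, haJ, haρ⟩ := hav x₀ ((g ^ (-J)) x₀)
    obtain ⟨c, hc, hcc, hcJ, hcρ⟩ := hav x₀ ((g ^ J) x₀)
    obtain ⟨e₁, he₁⟩ := exists_fin_four_embedding_avoiding
      (P := fun k => ∃ i : ℤ, x₀ ∈ unstableSet g ((g ^ i) (a k))) (Q := fun _ => False)
      (by
        rintro k l ⟨i, hi⟩ ⟨j, hj⟩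
        by_contra hkl
        refine haa k l hkl ⟨-j + i, ?_⟩
        have := eq_of_mem_unstableSet_of_periodic (mem_periodicPts_zpow (ha k) i)
          (mem_periodicPts_zpow (ha l) j) (mem_stableSet_trans hi (mem_stableSet_symm hj))
        rw [← g.zpow_zpow_apply, ← this, g.zpow_zpow_apply]
        simp) (by simp)
    obtain ⟨e₂, he₂⟩ := exists_fin_four_embedding_avoiding
      (P := fun k => ∃ i : ℤ, x₀ ∈ stableSet g ((g ^ i) (c k)))
      (Q := fun k => g.SameCycle (c k) (a (e₁ 0)))
      (by
        rintro k l ⟨i, hi⟩ ⟨j, hj⟩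
        by_contra hkl
        refine hcc k l hkl ⟨-j + i, ?_⟩
        have := eq_of_mem_stableSet_of_periodic (mem_periodicPts_zpow (hc k) i)
          (mem_periodicPts_zpow (hc l) j) (mem_stableSet_trans hi (mem_stableSet_symm hj))
        rw [← g.zpow_zpow_apply, ← this, g.zpow_zpow_apply]
        simp)
      (by
        intro k l hk hl
        by_contra hkl
        exact hcc k l hkl (hk.trans hl.symm))
    obtain ⟨v, hv⟩ := hlpε ((g ^ (-J)) x₀) (a (e₁ 0)) (by rw [edist_comm]; exact haJ _)
    have hv' : v ∈ localStableSet g ε ((g ^ (-J)) x₀) ∩ localUnstableSet g ε (a (e₁ 0)) := by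
      rw [hv]; exact mem_singleton v
    have hw : ∀ k, ∃ w, w ∈ localStableSet g ε (c (e₂ k)) ∩ localUnstableSet g ε ((g ^ J) x₀) := by
      intro k
      obtain ⟨w, hw⟩ := hlpε (c (e₂ k)) ((g ^ J) x₀) (hcJ _)
      exact ⟨w, by rw [hw]; exact mem_singleton w⟩
    choose w hw using hw
    refine ⟨J, a (e₁ 0), fun k => c (e₂ k), ha _, fun k => hc _,
      fun k l hkl => hcc _ _ fun h => hkl (e₂.injective h), fun k => (he₂ k).2, haρ _,
      fun k => hcρ _, fun i hi => (he₁ 0).1 ⟨i, hi⟩, fun k i hi => (he₂ k).1 ⟨i, hi⟩,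
      (g ^ J) v, fun k => (g ^ (-J)) (w k), ?_, fun k => ?_, ?_, fun k => ?_⟩
    · rw [mem_localStableSet_iff]
      intro n hn
      have := hN₁ _ _ (localStableSet_mono hεε₀ _ hv'.1) (n + J) (by lia)
      rw [g.zpow_zpow_apply] at this ⊢
      simpa using this
    · rw [mem_localUnstableSet_iff]
      intro n hn
      have := hN₂ _ _ (localUnstableSet_mono hεε₀ _ (hw k).2) (n + -J) (by lia)
      rw [g.zpow_zpow_apply] at this ⊢
      simpa using this
    · exact zpow_mem_unstableSet (hexp.localUnstableSet_subset hg hg' _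
        (localUnstableSet_mono hεε₀ _ hv'.2)) J
    · exact zpow_mem_stableSet (hexp.localStableSet_subset hg hg' _
        (localStableSet_mono hεε₀ _ (hw k).1)) (-J)
  have hq : ∀ k, ∃ y, IsQuadrilateral g δ ε x₀ (x₁' k) x₂' y := fun k =>
    let ⟨y, hy, _⟩ := hunique _ (hx₁' k) _ hx₂'
    ⟨y, hx₁' k, hx₂', hy.1, hy.2⟩
  choose y hq using hq
  have hys : ∀ k, y k ∈ stableSet g ((g ^ (-J)) (c k)) := fun k =>
    mem_stableSet_trans (hx₁c k) (hasym _ _ _ (hq k)).2.2.1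
  have hyu : ∀ k, y k ∈ unstableSet g ((g ^ J) a) := fun k =>
    mem_stableSet_trans hx₂a (hasym _ _ _ (hq k)).2.2.2
  -- The forward limit orbit of `y k` identifies `k`. Were `y k` periodic, it would lie on both the
  -- orbit of `a` and that of `c k`, which are distinct.
  have hdistinct : ∀ k l (n : ℤ), (g ^ n) (y k) = y l → n = 0 ∧ k = l := by
    intro k l n h
    have hkl : k = l := by
      by_contra hkl
      have h1 : y l ∈ stableSet g ((g ^ (n + -J)) (c k)) := by
        rw [← h, ← g.zpow_zpow_apply]
        exact zpow_mem_stableSet (hys k) n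
      have h2 := eq_of_mem_stableSet_of_periodic (mem_periodicPts_zpow (hc k) _)
        (mem_periodicPts_zpow (hc l) _) (mem_stableSet_trans h1 (mem_stableSet_symm (hys l)))
      refine hcc k l hkl ⟨J + (n + -J), ?_⟩
      rw [← g.zpow_zpow_apply, ← h2, g.zpow_zpow_apply]
      simp
    subst hkl
    refine ⟨?_, rfl⟩
    by_contra hn
    have hyp : y k ∈ Function.periodicPts g := by
      refine ⟨n.natAbs, by lia, ?_⟩
      change g^[n.natAbs] (y k) = y k
      rw [← g.zpow_natCast_apply]
      rcases abs_choice n with h' | h' <;> rw [Int.natCast_natAbs, h']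
      · exact h
      · conv_lhs => rw [← h]
        rw [g.zpow_zpow_apply]
        simp
    have h1 := eq_of_mem_stableSet_of_periodic (mem_periodicPts_zpow (hc k) _) hyp (hys k)
    have h2 := eq_of_mem_unstableSet_of_periodic (mem_periodicPts_zpow ha _) hyp (hyu k)
    refine hac k ⟨-J + -J, ?_⟩
    rw [← g.zpow_zpow_apply, ← h1, h2, g.zpow_zpow_apply]
    simp
  have hLne : ∀ {p : X}, ρ < edist p x₀ → L p ≠ L x₀ := fun hp h =>
    absurd ((hmesh _ _ h).trans (min_le_left _ _)) (not_le.2 hp)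
  -- far from time zero the marked points are away from `x₀`
  have hfar : ∀ k, ∀ᶠ N : ℤ in atTop, ∀ n : ℤ, N ≤ |n| → L ((g ^ n) (y k)) ≠ L x₀ := by
    intro k
    obtain ⟨N₁, h₁⟩ := mem_stableSet_iff.1 (hys k) r hr
    obtain ⟨N₂, h₂⟩ := mem_unstableSet_iff.1 (hyu k) r hr
    filter_upwards [eventually_ge_atTop N₁, eventually_ge_atTop (-N₂)] with N hN₁ hN₂ n hn
    rcases le_abs.1 hn with hn | hn
    · rw [hLr _ _ (h₁ n (by lia)), g.zpow_zpow_apply]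
      exact hLne (hcρ k _)
    · rw [hLr _ _ (h₂ n (by lia)), g.zpow_zpow_apply]
      exact hLne (haρ _)
  obtain ⟨J', hJ'⟩ := (eventually_all.2 hfar).exists
  -- Equal backward itineraries would make `x₀` backward asymptotic to the orbit of `a`, which the
  -- choice of `a` excludes; `hforw` is the mirror image for `c k`.
  have hback : ∀ k (n : ℤ), ∃ j : ℤ, j ≤ 0 ∧ L ((g ^ j) x₀) ≠ L ((g ^ (j - n)) (y k)) := by
    intro k n
    by_contra! hcon
    refine hax₀ (-n + J) ?_
    rw [← g.zpow_zpow_apply]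
    refine mem_stableSet_trans (zpow_mem_unstableSet (hyu k) (-n))
      (hexp.localUnstableSet_subset hg hg' _ (mem_localUnstableSet_iff.2 fun j hj => ?_))
    rw [g.zpow_zpow_apply]
    exact (hmesh _ _ (hcon j hj)).trans (min_le_right _ _)
  have hforw : ∀ k (n : ℤ), ∃ j : ℤ, 0 ≤ j ∧ L ((g ^ j) x₀) ≠ L ((g ^ (j - n)) (y k)) := by
    intro k n
    by_contra! hcon
    refine hcx₀ k (-n + -J) ?_
    rw [← g.zpow_zpow_apply]
    refine mem_stableSet_trans (zpow_mem_stableSet (hys k) (-n))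
      (hexp.localStableSet_subset hg hg' _ (mem_localStableSet_iff.2 fun j hj => ?_))
    rw [g.zpow_zpow_apply]
    exact (hmesh _ _ (hcon j hj)).trans (min_le_right _ _)
  have hsep : ∀ k l (n m : ℤ), (n ≠ m ∨ k ≠ l) →
      ∃ j : ℤ, L ((g ^ (j - n)) (y k)) ≠ L ((g ^ (j - m)) (y l)) := by
    intro k l n m h
    by_contra! hcon
    have h1 : (g ^ (-n)) (y k) = (g ^ (-m)) (y l) := hexp _ _ fun j => by
      rw [g.zpow_zpow_apply, g.zpow_zpow_apply]
      exact (hmesh _ _ (hcon j)).trans (min_le_right _ _)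
    have h2 : (g ^ (m - n)) (y k) = y l := by
      rw [sub_eq_add_neg, ← g.zpow_zpow_apply, h1, g.zpow_zpow_apply]
      simp
    have := hdistinct k l _ h2
    lia
  choose jb hjb hjb' using hback
  choose jf hjf hjf' using hforw
  choose! js hjs using hsep
  -- Only visit times in `[-J', J']` need a separating coordinate, and `J'` does not depend on `K`.
  -- Hence one `K` can contain all these finitely many coordinates, shifted by the visit times.
  have hev : ∀ᶠ K : ℤ in atTop, (∀ k, ∀ n ∈ Finset.Icc (-J') J',
      |jb k n| + |n| ≤ K ∧ |jf k n| + |n| ≤ K) ∧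
      (∀ k l, ∀ n ∈ Finset.Icc (-J') J', ∀ m ∈ Finset.Icc (-J') J',
        |js k l n m| + |n| ≤ K ∧ |js k l n m| + |m| ≤ K) ∧ 0 ≤ K := by
    simp only [eventually_and, eventually_all, eventually_all_finset, eventually_ge_atTop,
      implies_true, and_self]
  obtain ⟨K, hK₁, hK₂, hK₀⟩ := hev.exists
  let C : Fin 4 → Set X := fun k => {z | ∀ j ∈ Finset.Icc (-K) K, L ((g ^ j) z) = L ((g ^ j) (y k))}
  have hC : ∀ {k z} {n : ℤ}, (g ^ n) z ∈ C k → ∀ j : ℤ, |j| + |n| ≤ K →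
      L ((g ^ j) z) = L ((g ^ (j - n)) (y k)) := by
    intro k z n h j hj
    have h1 := h (j - n) (Finset.mem_Icc.2 ⟨by
      have := neg_abs_le j; have := le_abs_self n; lia, by
      have := le_abs_self j; have := neg_abs_le n; lia⟩)
    rwa [g.zpow_zpow_apply, sub_add_cancel] at h1
  -- The cylinder condition read at time `0` of `z` gives `g^(-n) (y k)` the label of `x₀`,
  -- impossible for `|n| ≥ J'`.
  have hwin : ∀ {k z} {n : ℤ}, |n| ≤ K → L z = L x₀ → (g ^ n) z ∈ C k →
      n ∈ Finset.Icc (-J') J' := by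
    intro k z n hn hz h
    have h1 := hC h 0 (by simpa using hn)
    rw [zpow_zero, Equiv.Perm.one_apply, hz, zero_sub] at h1
    by_contra hnJ
    refine hJ' k (-n) ?_ h1.symm
    rw [Finset.mem_Icc, ← abs_le, not_le] at hnJ
    rw [abs_neg]
    exact hnJ.le
  have hnoB : ∀ {k z} {n : ℤ}, |n| ≤ K → (∀ j : ℤ, j ≤ 0 → L ((g ^ j) z) = L ((g ^ j) x₀)) →
      (g ^ n) z ∉ C k := by
    intro k z n hn hz h
    have hnJ := hwin hn (by simpa using hz 0 le_rfl) h
    exact hjb' k n ((hz _ (hjb k n)).symm.trans (hC h _ (hK₁ k n hnJ).1))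
  have hnoF : ∀ {k z} {n : ℤ}, |n| ≤ K → (∀ j : ℤ, 0 ≤ j → L ((g ^ j) z) = L ((g ^ j) x₀)) →
      (g ^ n) z ∉ C k := by
    intro k z n hn hz h
    have hnJ := hwin hn (by simpa using hz 0 le_rfl) h
    exact hjf' k n ((hz _ (hjf k n)).symm.trans (hC h _ (hK₁ k n hnJ).2))
  have hCF : ∀ {k z w} {n : ℤ}, K ≤ n →
      (∀ j : ℤ, 0 ≤ j → L ((g ^ j) z) = L ((g ^ j) w)) → ((g ^ n) z ∈ C k ↔ (g ^ n) w ∈ C k) := by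
    intro k z w n hn h
    refine forall₂_congr fun j hj => ?_
    rw [Finset.mem_Icc] at hj
    rw [g.zpow_zpow_apply, g.zpow_zpow_apply, h _ (by lia)]
  have hCB : ∀ {k z w} {n : ℤ}, n ≤ -K →
      (∀ j : ℤ, j ≤ 0 → L ((g ^ j) z) = L ((g ^ j) w)) → ((g ^ n) z ∈ C k ↔ (g ^ n) w ∈ C k) := by
    intro k z w n hn h
    refine forall₂_congr fun j hj => ?_
    rw [Finset.mem_Icc] at hj
    rw [g.zpow_zpow_apply, g.zpow_zpow_apply, h _ (by lia)]
  refine ⟨C, K, ?_⟩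
  constructor
  · exact fun k => isClopen_cylinder hg hg' hL (y k) _
  · exact hunique
  · exact hasym
  · exact fun x₁ x₂ z h n hn k => ⟨hCF hn (lab1 _ _ _ h), hCF hn (lab4 _ _ _ h)⟩
  · exact fun x₁ x₂ z h n hn k => ⟨hCB hn (lab2 _ _ _ h), hCB hn (lab3 _ _ _ h)⟩
  · exact fun x₁ x₂ z h n hn k => ⟨hnoB hn fun _ _ => rfl, hnoB hn (lab3 _ _ _ h),
      hnoF hn (lab4 _ _ _ h)⟩
  · intro x₁ x₂ z h n m hn hm k l hk hl
    have hz : L z = L x₀ := by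
      have h1 := lab1 _ _ _ h 0 le_rfl
      have h2 := lab3 _ _ _ h 0 le_rfl
      simpa using h1.trans h2
    have hnJ := hwin hn hz hk
    have hmJ := hwin hm hz hl
    by_contra hne
    have hne' : n ≠ m ∨ k ≠ l := by tauto
    have hb := hK₂ k l n hnJ m hmJ
    exact hjs k l n m hne' ((hC hk _ hb.1).symm.trans (hC hl _ hb.2))
  · exact fun k => ⟨_, _, _, hq k, fun _ _ => rfl⟩
  · exact hK₀

end Markers

/-! ### Stable and unstable sets of the suspension -/

section SuspensionShift

variable {M : Type*}

theorem suspensionShift_iterate (f : M ≃ M) (r : M → ℝ) (n : ℕ) (x : M) (u : ℝ) :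
    (suspensionShift f r)^[n] (x, u) = (f^[n] x, u - ∑ i ∈ Finset.range n, r (f^[i] x)) := by
  induction n with
  | zero => simp
  | succ n ih =>
    rw [Function.iterate_succ_apply', ih, Finset.sum_range_succ, Function.iterate_succ_apply']
    simp only [suspensionShift, Equiv.coe_fn_mk, Prod.mk.injEq, true_and]
    ring

theorem suspensionShift_symm_iterate (f : M ≃ M) (r : M → ℝ) (n : ℕ) (x : M) (u : ℝ) :
    (suspensionShift f r).symm^[n] (x, u) =
      (f.symm^[n] x, u + ∑ i ∈ Finset.range n, r (f.symm^[i + 1] x)) := by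
  induction n with
  | zero => simp
  | succ n ih =>
    rw [Function.iterate_succ_apply', ih, Finset.sum_range_succ]
    simp only [suspensionShift, Equiv.coe_fn_symm_mk, Prod.mk.injEq,
      Function.iterate_succ_apply', true_and]
    ring

variable [EMetricSpace M]

/-- The height difference is eventually the constant `D`, which tends to `0` only if it is `0`. -/
theorem tendsto_edist_prod_of_eventually_eq {a b : ℕ → M} {s t : ℕ → ℝ} {K : ℕ} {D : ℝ}
    (h : ∀ n ≥ K, s n - t n = D) :
    Tendsto (fun n => edist (a n, s n) (b n, t n)) atTop (𝓝 0) ↔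
      Tendsto (fun n => edist (a n) (b n)) atTop (𝓝 0) ∧ D = 0 := by
  simp only [Prod.edist_eq]
  constructor
  · intro H
    refine ⟨tendsto_of_tendsto_of_tendsto_of_le_of_le tendsto_const_nhds H
      (fun _ => zero_le) fun _ => le_max_left _ _, ?_⟩
    have h1 : Tendsto (fun n => edist (s n) (t n)) atTop (𝓝 0) :=
      tendsto_of_tendsto_of_tendsto_of_le_of_le tendsto_const_nhds H
        (fun _ => zero_le) fun _ => le_max_right _ _
    have h2 : (fun n => edist (s n) (t n)) =ᶠ[atTop] fun _ => ENNReal.ofReal |D| := by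
      filter_upwards [eventually_ge_atTop K] with n hn
      rw [edist_dist, Real.dist_eq, h n hn]
    have h3 := tendsto_nhds_unique (h1.congr' h2) tendsto_const_nhds
    have h4 := ENNReal.ofReal_eq_zero.1 h3.symm
    exact abs_nonpos_iff.1 h4
  · rintro ⟨H, rfl⟩
    refine H.congr' ?_
    filter_upwards [eventually_ge_atTop K] with n hn
    rw [sub_eq_zero.1 (h n hn), edist_self]
    simp

/-- When the roofs agree from time `K` on, the height difference freezes there, so the height on the
stable leaf is given by finite sums. -/
theorem mem_stableSet_suspensionShift_iff {f : M ≃ M} {r : M → ℝ} {K : ℕ} {x y : M} {u v : ℝ}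
    (h : ∀ n ≥ K, r (f^[n] y) = r (f^[n] x)) :
    (y, v) ∈ stableSet (suspensionShift f r) (x, u) ↔ y ∈ stableSet f x ∧
      v - ∑ i ∈ Finset.range K, r (f^[i] y) = u - ∑ i ∈ Finset.range K, r (f^[i] x) := by
  simp only [stableSet, mem_ofPred_eq, suspensionShift_iterate]
  rw [tendsto_edist_prod_of_eventually_eq (K := K)
    (D := (v - ∑ i ∈ Finset.range K, r (f^[i] y)) - (u - ∑ i ∈ Finset.range K, r (f^[i] x))),
    sub_eq_zero]
  intro n hn
  induction n, hn using Nat.le_induction with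
  | base => rfl
  | succ n hn ih =>
    rw [Finset.sum_range_succ, Finset.sum_range_succ, h n hn, ← ih]
    ring

theorem mem_unstableSet_suspensionShift_iff {f : M ≃ M} {r : M → ℝ} {K : ℕ} {x y : M} {u v : ℝ}
    (h : ∀ n ≥ K, r (f.symm^[n + 1] y) = r (f.symm^[n + 1] x)) :
    (y, v) ∈ unstableSet (suspensionShift f r) (x, u) ↔ y ∈ unstableSet f x ∧
      v + ∑ i ∈ Finset.range K, r (f.symm^[i + 1] y) =
        u + ∑ i ∈ Finset.range K, r (f.symm^[i + 1] x) := by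
  simp only [unstableSet, stableSet, mem_ofPred_eq, suspensionShift_symm_iterate]
  rw [tendsto_edist_prod_of_eventually_eq (K := K)
    (D := (v + ∑ i ∈ Finset.range K, r (f.symm^[i + 1] y)) -
      (u + ∑ i ∈ Finset.range K, r (f.symm^[i + 1] x))), sub_eq_zero]
  intro n hn
  induction n, hn using Nat.le_induction with
  | base => rfl
  | succ n hn ih =>
    rw [Finset.sum_range_succ, Finset.sum_range_succ, h n hn, ← ih]
    ring

end SuspensionShift

/-! ### Restriction to an invariant set -/

section Restriction

variable {X M : Type*} [EMetricSpace X] [EMetricSpace M]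

/-- Stable sets depend only on distances along orbits. This transfers the whole problem from `M` to
the subspace `Λ`, where total disconnectedness and compactness are available. -/
theorem mem_stableSet_isometry_iff {X M : Type*} [PseudoEMetricSpace X] [PseudoEMetricSpace M]
    {e : X → M} (he : Isometry e) {g : X ≃ X} {f : M ≃ M}
    (h : Function.Semiconj e g f) {x y : X} :
    e y ∈ stableSet f (e x) ↔ y ∈ stableSet g x := by
  simp only [stableSet, mem_ofPred_eq, ← (h.iterate_right _).eq, he.edist_eq]

theorem mem_localStableSet_isometry_iff {X M : Type*} [PseudoEMetricSpace X]
    [PseudoEMetricSpace M] {e : X → M} (he : Isometry e) {g : X ≃ X} {f : M ≃ M}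
    (h : Function.Semiconj e g f) {ε : ℝ≥0∞} {x y : X} :
    e y ∈ localStableSet f ε (e x) ↔ y ∈ localStableSet g ε x := by
  simp only [localStableSet, mem_ofPred_eq, ← (h.iterate_right _).eq, he.edist_eq]

theorem semiconj_symm {X M : Type*} {e : X → M} {g : X ≃ X} {f : M ≃ M}
    (h : Function.Semiconj e g f) : Function.Semiconj e g.symm f.symm := fun x => by
  rw [Equiv.eq_symm_apply, ← h.eq, Equiv.apply_symm_apply]

theorem semiconj_suspensionShift {X M : Type*} {e : X → M} {g : X ≃ X} {f : M ≃ M}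
    (h : Function.Semiconj e g f) (r : M → ℝ) :
    Function.Semiconj (Prod.map e id) (suspensionShift g (r ∘ e)) (suspensionShift f r) :=
  fun z => by simp [suspensionShift, h.eq]

variable {e : X → M} {g : X ≃ X} {f : M ≃ M}

theorem mem_flowLocalStable_isometry_iff (he : Isometry e) (h : Function.Semiconj e g f)
    {r : M → ℝ} {ε : ℝ≥0∞} {z w : X × ℝ} :
    Prod.map e id w ∈ flowLocalStable f r ε (Prod.map e id z) ↔
      w ∈ flowLocalStable g (r ∘ e) ε z :=
  and_congr (mem_localStableSet_isometry_iff he h)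
    (mem_stableSet_isometry_iff (he.prodMap isometry_id) (semiconj_suspensionShift h r))

theorem mem_flowLocalUnstable_isometry_iff (he : Isometry e) (h : Function.Semiconj e g f)
    {r : M → ℝ} {ε : ℝ≥0∞} {z w : X × ℝ} :
    Prod.map e id w ∈ flowLocalUnstable f r ε (Prod.map e id z) ↔
      w ∈ flowLocalUnstable g (r ∘ e) ε z :=
  and_congr (mem_localStableSet_isometry_iff he (semiconj_symm h))
    (mem_stableSet_isometry_iff (he.prodMap isometry_id)
      (semiconj_symm (semiconj_suspensionShift h r)))

theorem isTemporalDistance_isometry_iff (he : Isometry e) (h : Function.Semiconj e g f)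
    {r : M → ℝ} {ε : ℝ≥0∞} {z₁ z₂ : X × ℝ} {T : ℝ} :
    IsTemporalDistance f r (range e) ε (Prod.map e id z₁) (Prod.map e id z₂) T ↔
      IsTemporalDistance g (r ∘ e) univ ε z₁ z₂ T := by
  constructor
  · rintro ⟨⟨_, u₃⟩, ⟨_, u₄⟩, ⟨x₃, rfl⟩, ⟨x₄, rfl⟩, h₃, h₄, hT⟩
    refine ⟨(x₃, u₃), (x₄, u₄), mem_univ _, mem_univ _,
      (mem_flowLocalUnstable_isometry_iff he h).1 h₃,
      (mem_flowLocalStable_isometry_iff he h).1 h₄, ?_⟩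
    simpa [coordFlow, he.injective.eq_iff] using hT
  · rintro ⟨z₃, z₄, -, -, h₃, h₄, rfl⟩
    exact ⟨_, _, mem_range_self _, mem_range_self _,
      (mem_flowLocalUnstable_isometry_iff he h).2 h₃,
      (mem_flowLocalStable_isometry_iff he h).2 h₄, rfl⟩

theorem mem_temporalDomain_isometry_iff (he : Isometry e) (h : Function.Semiconj e g f)
    {r : M → ℝ} {δ : ℝ≥0∞} {z₀ : X × ℝ} {p : (M × ℝ) × (M × ℝ)} :
    p ∈ temporalDomain f r (range e) δ (Prod.map e id z₀) ↔
      ∃ q ∈ temporalDomain g (r ∘ e) univ δ z₀,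
        (Prod.map e id q.1, Prod.map e id q.2) = p := by
  constructor
  · obtain ⟨⟨_, u₁⟩, ⟨_, u₂⟩⟩ := p
    rintro ⟨⟨x₁, rfl⟩, ⟨x₂, rfl⟩, h₁, h₂⟩
    exact ⟨((x₁, u₁), (x₂, u₂)), ⟨mem_univ _, mem_univ _,
      (mem_flowLocalUnstable_isometry_iff he h).1 h₁,
      (mem_flowLocalStable_isometry_iff he h).1 h₂⟩, rfl⟩
  · rintro ⟨q, ⟨-, -, h₁, h₂⟩, rfl⟩
    exact ⟨mem_range_self _, mem_range_self _, (mem_flowLocalUnstable_isometry_iff he h).2 h₁,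
      (mem_flowLocalStable_isometry_iff he h).2 h₂⟩

theorem temporalRange_isometry (he : Isometry e) (h : Function.Semiconj e g f)
    (r : M → ℝ) (δ ε : ℝ≥0∞) (z₀ : X × ℝ) :
    temporalRange f r (range e) δ ε (Prod.map e id z₀) =
      temporalRange g (r ∘ e) univ δ ε z₀ := by
  ext T
  constructor
  · rintro ⟨p, hp, hT⟩
    obtain ⟨q, hq, rfl⟩ := (mem_temporalDomain_isometry_iff he h).1 hp
    exact ⟨q, hq, (isTemporalDistance_isometry_iff he h).1 hT⟩
  · rintro ⟨q, hq, hT⟩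
    exact ⟨_, (mem_temporalDomain_isometry_iff he h).2 ⟨q, hq, rfl⟩,
      (isTemporalDistance_isometry_iff he h).2 hT⟩

end Restriction

/-! ### Temporal distances for roof functions built from marker families -/

section Temporal

theorem Finset.sum_Ico_neg_eq (F : ℤ → ℝ) (K : ℕ) :
    ∑ n ∈ Finset.Ico (-(K : ℤ)) K, F n =
      ∑ i ∈ Finset.range K, F i + ∑ i ∈ Finset.range K, F (-((i + 1 : ℕ) : ℤ)) := by
  induction K with
  | zero => simp
  | succ K ih =>
    have h : Finset.Ico (-((K + 1 : ℕ) : ℤ)) ((K + 1 : ℕ) : ℤ) =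
        insert (K : ℤ) (insert (-((K + 1 : ℕ) : ℤ)) (Finset.Ico (-(K : ℤ)) K)) := by
      ext n
      simp only [Finset.mem_Ico, Finset.mem_insert]
      lia
    rw [h, Finset.sum_insert (by simp; lia), Finset.sum_insert (by simp), ih,
      Finset.sum_range_succ, Finset.sum_range_succ]
    ring

/-- Sum of `R` over the orbit segment of length `2 K` centred at `x`. -/
noncomputable def windowSum {X : Type*} (g : Equiv.Perm X) (R : X → ℝ) (K : ℕ) (x : X) : ℝ :=
  ∑ n ∈ Finset.Ico (-(K : ℤ)) K, R ((g ^ n) x)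

theorem windowSum_eq {X : Type*} (g : Equiv.Perm X) (R : X → ℝ) (K : ℕ) (x : X) :
    windowSum g R K x = ∑ i ∈ Finset.range K, R (g^[i] x) +
      ∑ i ∈ Finset.range K, R (g.symm^[i + 1] x) := by
  simp only [windowSum, Finset.sum_Ico_neg_eq fun n => R ((g ^ n) x), g.zpow_natCast_apply,
    g.zpow_neg_natCast_apply]

variable {X : Type*} [EMetricSpace X] {g : Equiv.Perm X} {δ ε : ℝ≥0∞} {x₀ : X}

/-- The temporal distance is a fourfold difference of sums of the roof function. -/
theorem isTemporalDistance_iff {R : X → ℝ} {K : ℕ}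
    (hunique : ∀ x₁ ∈ localUnstableSet g δ x₀, ∀ x₂ ∈ localStableSet g δ x₀,
      ∃! y, y ∈ localStableSet g ε x₁ ∩ localUnstableSet g ε x₂)
    (hasym : ∀ x₁ x₂ y, IsQuadrilateral g δ ε x₀ x₁ x₂ y →
      x₁ ∈ unstableSet g x₀ ∧ x₂ ∈ stableSet g x₀ ∧ y ∈ stableSet g x₁ ∧ y ∈ unstableSet g x₂)
    (hforward : ∀ x₁ x₂ y, IsQuadrilateral g δ ε x₀ x₁ x₂ y → ∀ n : ℤ, K ≤ n →
      R ((g ^ n) y) = R ((g ^ n) x₁) ∧ R ((g ^ n) x₂) = R ((g ^ n) x₀))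
    (hbackward : ∀ x₁ x₂ y, IsQuadrilateral g δ ε x₀ x₁ x₂ y → ∀ n : ℤ, n ≤ -K →
      R ((g ^ n) y) = R ((g ^ n) x₂) ∧ R ((g ^ n) x₁) = R ((g ^ n) x₀)) (u₀ : ℝ) :
    (∀ p ∈ temporalDomain g R univ δ (x₀, u₀), ∃ y, IsQuadrilateral g δ ε x₀ p.1.1 p.2.1 y ∧
      ∀ T, IsTemporalDistance g R univ ε p.1 p.2 T ↔ T = windowSum g R K y -
        windowSum g R K p.1.1 - windowSum g R K p.2.1 + windowSum g R K x₀) ∧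
    ∀ x₁ x₂ y, IsQuadrilateral g δ ε x₀ x₁ x₂ y → ∃ u₁ u₂,
      ((x₁, u₁), (x₂, u₂)) ∈ temporalDomain g R univ δ (x₀, u₀) := by
  have hS : ∀ {x₁ x₂ y}, IsQuadrilateral g δ ε x₀ x₁ x₂ y → ∀ n : ℕ, K ≤ n →
      R (g^[n] y) = R (g^[n] x₁) ∧ R (g^[n] x₂) = R (g^[n] x₀) := fun h n hn => by
    simpa only [g.zpow_natCast_apply] using hforward _ _ _ h n (by exact_mod_cast hn)
  have hU : ∀ {x₁ x₂ y}, IsQuadrilateral g δ ε x₀ x₁ x₂ y → ∀ n : ℕ, K ≤ n →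
      R (g.symm^[n + 1] y) = R (g.symm^[n + 1] x₂) ∧
        R (g.symm^[n + 1] x₁) = R (g.symm^[n + 1] x₀) := fun h n hn => by
    simpa only [g.zpow_neg_natCast_apply] using
      hbackward _ _ _ h (-((n + 1 : ℕ) : ℤ)) (by push_cast; lia)
  refine ⟨?_, ?_⟩
  · rintro ⟨⟨x₁, u₁⟩, ⟨x₂, u₂⟩⟩ ⟨-, -, ⟨h₁, h₁'⟩, h₂, h₂'⟩
    obtain ⟨y, ⟨hy₁, hy₂⟩, huniq⟩ := hunique x₁ h₁ x₂ h₂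
    have hq : IsQuadrilateral g δ ε x₀ x₁ x₂ y := ⟨h₁, h₂, hy₁, hy₂⟩
    obtain ⟨-, -, ha₁, ha₂⟩ := hasym _ _ _ hq
    -- With `e₃` and `e₄` below these are the four height equations; in `T = u₄ - u₃` the base
    -- height `u₀` cancels.
    have e₁ := ((mem_unstableSet_suspensionShift_iff fun n hn => (hU hq n hn).2).1 h₁').2
    have e₂ := ((mem_stableSet_suspensionShift_iff fun n hn => (hS hq n hn).2).1 h₂').2
    refine ⟨y, hq, fun T => ?_⟩
    simp only [windowSum_eq]
    constructor
    · rintro ⟨⟨x₃, u₃⟩, ⟨x₄, u₄⟩, -, -, ⟨h₃, h₃'⟩, ⟨h₄, h₄'⟩, hT⟩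
      obtain ⟨rfl, rfl⟩ : x₃ = x₄ ∧ u₃ + T = u₄ := by simpa [coordFlow] using hT
      obtain rfl : x₃ = y := huniq _ ⟨h₄, h₃⟩
      have e₃ := ((mem_unstableSet_suspensionShift_iff fun n hn => (hU hq n hn).1).1 h₃').2
      have e₄ := ((mem_stableSet_suspensionShift_iff fun n hn => (hS hq n hn).1).1 h₄').2
      linarith
    · rintro rfl
      refine ⟨(y, u₂ + ∑ i ∈ Finset.range K, R (g.symm^[i + 1] x₂) -
        ∑ i ∈ Finset.range K, R (g.symm^[i + 1] y)), (y, u₁ - ∑ i ∈ Finset.range K, R (g^[i] x₁) +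
          ∑ i ∈ Finset.range K, R (g^[i] y)), mem_univ _, mem_univ _,
        ⟨hy₂, (mem_unstableSet_suspensionShift_iff fun n hn => (hU hq n hn).1).2
          ⟨ha₂, by ring⟩⟩,
        ⟨hy₁, (mem_stableSet_suspensionShift_iff fun n hn => (hS hq n hn).1).2
          ⟨ha₁, by ring⟩⟩, ?_⟩
      simp only [coordFlow, Prod.mk.injEq, true_and]
      linarith
  · intro x₁ x₂ y hq
    obtain ⟨ha₁, ha₂, -, -⟩ := hasym _ _ _ hq
    exact ⟨u₀ + ∑ i ∈ Finset.range K, R (g.symm^[i + 1] x₀) -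
        ∑ i ∈ Finset.range K, R (g.symm^[i + 1] x₁),
      u₀ - ∑ i ∈ Finset.range K, R (g^[i] x₀) + ∑ i ∈ Finset.range K, R (g^[i] x₂),
      mem_univ _, mem_univ _,
      ⟨hq.left, (mem_unstableSet_suspensionShift_iff fun n hn => (hU hq n hn).2).2
        ⟨ha₁, by ring⟩⟩,
      ⟨hq.right, (mem_stableSet_suspensionShift_iff fun n hn => (hS hq n hn).2).2
        ⟨ha₂, by ring⟩⟩⟩

/-- Three corners contribute only the constant window sum of `κ`; the fourth contributes the same
plus at most one `c k`, so this value alone survives the fourfold difference. -/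
theorem IsMarkerFamily.temporalRange_eq {ι : Type*} [Fintype ι] {C : ι → Set X} {K : ℕ}
    (h : IsMarkerFamily g δ ε x₀ C K) {R : X → ℝ} {κ : ℝ} {c : ι → ℝ}
    (hR : ∀ x, R x = κ + ∑ k, (C k).indicator (fun _ => c k) x) (u₀ : ℝ) :
    (∀ p ∈ temporalDomain g R univ δ (x₀, u₀),
      ∃! T : ℝ, IsTemporalDistance g R univ ε p.1 p.2 T) ∧
    temporalRange g R univ δ ε (x₀, u₀) = insert 0 (range c) := by
  have hcongr : ∀ {x y}, (∀ k, x ∈ C k ↔ y ∈ C k) → R x = R y := fun hxy => by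
    classical
    simp only [hR, indicator_apply, hxy]
  have hzero : ∀ {x}, (∀ n ∈ Finset.Ico (-(K : ℤ)) K, ∀ k, (g ^ n) x ∉ C k) →
      windowSum g R K x = ∑ n ∈ Finset.Ico (-(K : ℤ)) K, κ := fun hx => by
    refine Finset.sum_congr rfl fun n hn => ?_
    rw [hR, Finset.sum_eq_zero, add_zero]
    exact fun k _ => indicator_of_notMem (hx n hn k) _
  have habs : ∀ {n}, n ∈ Finset.Ico (-(K : ℤ)) K → |n| ≤ K := fun hn => by
    rw [Finset.mem_Ico] at hn
    exact abs_le.2 ⟨hn.1, hn.2.le⟩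
  have hone : ∀ {x₁ x₂ y}, IsQuadrilateral g δ ε x₀ x₁ x₂ y → ∀ n ∈ Finset.Ico (-(K : ℤ)) K, ∀ k,
      (g ^ n) y ∈ C k → windowSum g R K y = (∑ n ∈ Finset.Ico (-(K : ℤ)) K, κ) + c k := by
    intro x₁ x₂ y hq n hn k hk
    simp only [windowSum, hR, Finset.sum_add_distrib]
    congr 1
    rw [Finset.sum_eq_single_of_mem n hn, Finset.sum_eq_single_of_mem k (Finset.mem_univ _),
      indicator_of_mem hk]
    · exact fun l _ hl => indicator_of_notMem
        (fun hmem => hl (h.visit_unique _ _ _ hq n n (habs hn) (habs hn) l k hmem hk).2) _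
    · exact fun m hm hne => Finset.sum_eq_zero fun l _ => indicator_of_notMem
        (fun hmem => hne (h.visit_unique _ _ _ hq m n (habs hm) (habs hn) l k hmem hk).1) _
  have hcorner : ∀ {x₁ x₂ y}, IsQuadrilateral g δ ε x₀ x₁ x₂ y →
      windowSum g R K x₁ = (∑ n ∈ Finset.Ico (-(K : ℤ)) K, κ) ∧
      windowSum g R K x₂ = (∑ n ∈ Finset.Ico (-(K : ℤ)) K, κ) ∧
      windowSum g R K x₀ = (∑ n ∈ Finset.Ico (-(K : ℤ)) K, κ) := fun hq =>
    ⟨hzero fun n hn k => (h.no_visit _ _ _ hq n (habs hn) k).2.1,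
      hzero fun n hn k => (h.no_visit _ _ _ hq n (habs hn) k).2.2,
      hzero fun n hn k => (h.no_visit _ _ _ hq n (habs hn) k).1⟩
  obtain ⟨hT, hdom⟩ := isTemporalDistance_iff (R := R) h.exists_unique h.asymptotic
    (fun x₁ x₂ y hq n hn => ⟨hcongr fun k => (h.forward _ _ _ hq n hn k).1,
      hcongr fun k => (h.forward _ _ _ hq n hn k).2⟩)
    (fun x₁ x₂ y hq n hn => ⟨hcongr fun k => (h.backward _ _ _ hq n hn k).1,
      hcongr fun k => (h.backward _ _ _ hq n hn k).2⟩) u₀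
  refine ⟨fun p hp => ?_, Subset.antisymm ?_ ?_⟩
  · obtain ⟨y, -, hy⟩ := hT p hp
    exact ⟨_, (hy _).2 rfl, fun T => (hy T).1⟩
  · rintro T ⟨p, hp, hpT⟩
    obtain ⟨y, hq, hy⟩ := hT p hp
    obtain ⟨e₁, e₂, e₀⟩ := hcorner hq
    rw [hy, e₁, e₂, e₀] at hpT
    by_cases hv : ∃ n ∈ Finset.Ico (-(K : ℤ)) K, ∃ k, (g ^ n) y ∈ C k
    · obtain ⟨n, hn, k, hk⟩ := hv
      rw [hone hq n hn k hk] at hpT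
      exact Or.inr ⟨k, by rw [hpT]; ring⟩
    · push Not at hv
      rw [hzero hv] at hpT
      exact Or.inl (by rw [hpT]; ring)
  · have hreach : ∀ {x₁ x₂ y}, IsQuadrilateral g δ ε x₀ x₁ x₂ y →
        windowSum g R K y - (∑ n ∈ Finset.Ico (-(K : ℤ)) K, κ) ∈
          temporalRange g R univ δ ε (x₀, u₀) := by
      intro x₁ x₂ y hq
      obtain ⟨u₁, u₂, hu⟩ := hdom _ _ _ hq
      obtain ⟨y', hq', hy'⟩ := hT _ hu
      obtain rfl : y' = y := (h.exists_unique _ hq.left _ hq.right).unique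
        ⟨hq'.stable, hq'.unstable⟩ ⟨hq.stable, hq.unstable⟩
      refine ⟨_, hu, (hy' _).2 ?_⟩
      obtain ⟨e₁, e₂, e₀⟩ := hcorner hq
      simp only [e₁, e₂, e₀]
      ring
    rintro T (rfl | ⟨k, rfl⟩)
    -- The degenerate quadrilateral realizes the value `0`.
    · have hq : IsQuadrilateral g δ ε x₀ x₀ x₀ x₀ :=
        ⟨self_mem_localUnstableSet _ _, self_mem_localStableSet _ _,
          self_mem_localStableSet _ _, self_mem_localUnstableSet _ _⟩
      have := hreach hq
      rwa [(hcorner hq).1, sub_self] at this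
    · obtain ⟨x₁, x₂, y, hq, hyk⟩ := h.exists_visit k
      -- The half-open window contains time `0` only if `K ≠ 0`. For `K = 0`, `forward` would pass
      -- the visit of `y` on to `x₁`, against `no_visit`.
      have hK : (0 : ℤ) ∈ Finset.Ico (-(K : ℤ)) K := by
        have hK' : K ≠ 0 := by
          rintro rfl
          have h1 := (h.forward _ _ _ hq 0 (by simp) k).1.1 (by simpa using hyk)
          exact (h.no_visit _ _ _ hq 0 (by simp) k).2.1 h1
        rw [Finset.mem_Ico]
        lia
      have := hreach hq
      rwa [hone hq 0 hK k (by simpa using hyk), add_sub_cancel_left] at this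

end Temporal

/-! ### Box dimension, a Diophantine ratio, smooth roofs and the main theorem -/

/-- The covering numbers stay between `1` and the cardinality while `log (1/η) → ∞`. Nonemptiness
matters because `ENNReal.log 0 = ⊥`. -/
theorem upperBoxDim_eq_zero_of_finite {X : Type*} [PseudoEMetricSpace X] {A : Set X}
    (hA : A.Finite) (hne : A.Nonempty) : upperBoxDim A = 0 := by
  obtain ⟨n, hn⟩ : ∃ n : ℕ, A.encard = n := ⟨_, hA.encard_eq_coe⟩
  set c : EReal := ENNReal.log (n : ℝ≥0∞) with hc
  have hc_top : c ≠ ⊤ := by simp [hc]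
  have hpos : ∀ᶠ η : ℝ≥0 in 𝓝[>] 0, 0 < Real.log (1 / (η : ℝ)) := by
    have h1 : ∀ᶠ η : ℝ≥0 in 𝓝[>] 0, η < 1 :=
      nhdsWithin_le_nhds (eventually_lt_nhds (by simp))
    filter_upwards [h1, self_mem_nhdsWithin] with η h1 h0
    have h0' : (0 : ℝ) < η := by exact_mod_cast h0
    exact Real.log_pos ((one_lt_div h0').2 (by exact_mod_cast h1))
  have hlow : ∀ η : ℝ≥0, 0 ≤ ENNReal.log ((Metric.coveringNumber η A : ℕ∞) : ℝ≥0∞) := by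
    intro η
    rw [← ENNReal.log_one]
    refine ENNReal.log_monotone ?_
    have : 1 ≤ Metric.coveringNumber η A :=
      Order.one_le_iff_pos.2 (Metric.coveringNumber_pos_iff.2 hne)
    exact_mod_cast this
  have hup : ∀ η : ℝ≥0, ENNReal.log ((Metric.coveringNumber η A : ℕ∞) : ℝ≥0∞) ≤ c := by
    intro η
    refine ENNReal.log_monotone ?_
    have : Metric.coveringNumber η A ≤ n := hn ▸ Metric.coveringNumber_le_encard_self A
    exact_mod_cast this
  have hc0 : 0 ≤ c := (hlow 1).trans (hup 1)
  lift c to ℝ using ⟨hc_top, ne_bot_of_le_ne_bot EReal.zero_ne_bot hc0⟩ with c' hc'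
  have hlim : Tendsto (fun η : ℝ≥0 => c' / Real.log (1 / (η : ℝ))) (𝓝[>] 0) (𝓝 0) := by
    refine Tendsto.const_div_atTop (Real.tendsto_log_atTop.comp ?_) c'
    simp only [one_div]
    refine tendsto_inv_nhdsGT_zero.comp (tendsto_nhdsWithin_iff.2 ⟨?_, ?_⟩)
    · exact (NNReal.continuous_coe.tendsto' 0 0 rfl).mono_left nhdsWithin_le_nhds
    · filter_upwards [self_mem_nhdsWithin] with η h0
      exact_mod_cast h0
  have hlim' : Tendsto (fun η : ℝ≥0 => ((c' / Real.log (1 / (η : ℝ)) : ℝ) : EReal))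
      (𝓝[>] 0) (𝓝 0) := (continuous_coe_real_ereal.tendsto' 0 0 rfl).comp hlim
  refine Tendsto.limsup_eq (tendsto_of_tendsto_of_tendsto_of_le_of_le' tendsto_const_nhds hlim'
    ?_ ?_)
  · filter_upwards [hpos] with η hη
    exact EReal.div_nonneg (hlow η) (by exact_mod_cast hη.le)
  · filter_upwards [hpos] with η hη
    rw [EReal.coe_div]
    exact EReal.div_le_div_right_of_nonneg (by exact_mod_cast hη.le) (hup η)

/-- The norm `2q² - p²` is a nonzero integer. If `|p| ≤ 3|q|`, the conjugate factor is at most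
`5|q|`, whence the constant `1/5`; otherwise `|q√2 - p| ≥ 1` already. -/
theorem isDiophantine_sqrt_two : IsDiophantine √2 := by
  refine ⟨1 / 5, by norm_num, 1, one_pos, fun p q hq => ?_⟩
  rw [Real.rpow_neg_one]
  have hs : (√2 : ℝ) ^ 2 = 2 := Real.sq_sqrt (by norm_num)
  have hs0 : 0 ≤ √2 := Real.sqrt_nonneg 2
  have hs1 : √2 ≤ 3 / 2 := by
    rw [Real.sqrt_le_left (by norm_num)]; norm_num
  have hq1 : (1 : ℝ) ≤ |(q : ℝ)| := by exact_mod_cast Int.one_le_abs hq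
  have hne : (2 * q ^ 2 - p ^ 2 : ℤ) ≠ 0 := by
    intro h
    refine irrational_sqrt_two ⟨|(p : ℚ) / q|, ?_⟩
    have hq' : (q : ℝ) ≠ 0 := by exact_mod_cast hq
    have h' : (2 : ℝ) * q ^ 2 - p ^ 2 = 0 := by exact_mod_cast h
    have h2 : (2 : ℝ) = (p / q) ^ 2 := by
      rw [div_pow, eq_div_iff (pow_ne_zero 2 hq')]; linarith
    rw [h2, Real.sqrt_sq_eq_abs]
    push_cast
    rfl
  have hprod : 1 ≤ |(q : ℝ) * √2 - p| * |(q : ℝ) * √2 + p| := by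
    rw [← abs_mul]
    have : ((q : ℝ) * √2 - p) * (q * √2 + p) = ((2 * q ^ 2 - p ^ 2 : ℤ) : ℝ) := by
      push_cast
      linear_combination (q : ℝ) ^ 2 * hs
    rw [this]
    exact_mod_cast Int.one_le_abs hne
  have hqs : |(q : ℝ) * √2| ≤ 3 / 2 * |(q : ℝ)| := by
    rw [abs_mul, abs_of_nonneg hs0, mul_comm]
    exact mul_le_mul_of_nonneg_right hs1 (abs_nonneg _)
  rw [← div_eq_mul_inv, div_le_iff₀ (by linarith)]
  set A := |(q : ℝ) * √2 - p|
  have hA : 0 ≤ A := abs_nonneg _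
  by_cases hp : |(p : ℝ)| ≤ 3 * |(q : ℝ)|
  · have hB : |(q : ℝ) * √2 + p| ≤ 5 * |(q : ℝ)| := (abs_add_le _ _).trans (by linarith)
    have := hprod.trans (mul_le_mul_of_nonneg_left hB hA)
    linarith
  · have h1 : |(p : ℝ)| ≤ A + |(q : ℝ) * √2| := by
      have := abs_sub_abs_le_abs_sub (p : ℝ) (q * √2)
      rw [abs_sub_comm] at this
      linarith
    have h2 : 1 ≤ A := by linarith
    nlinarith

theorem IsCantorSet.perfectSpace {M : Type*} [TopologicalSpace M] {Λ : Set M}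
    (h : IsCantorSet Λ) : PerfectSpace Λ := by
  refine perfectSpace_iff_forall_not_isolated.2 fun x => ?_
  rw [nhdsWithin_neBot]
  intro t ht
  obtain ⟨V, hV, hVt⟩ := mem_nhds_subtype Λ x t |>.1 ht
  obtain ⟨y, ⟨hyV, hyΛ⟩, hyx⟩ := preperfect_iff_nhds.1 h.perfect.acc x x.2 V hV
  exact ⟨⟨y, hyΛ⟩, hVt hyV, fun heq => hyx (congrArg Subtype.val heq)⟩

/-- A locally constant function on a compact set, given as a combination of indicators of clopen
sets, extends to a smooth positive function after adding a constant. -/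
theorem exists_contMDiff_pos_eq_sum_indicator {d : ℕ} {M : Type*} [TopologicalSpace M]
    [T2Space M] [CompactSpace M] [ChartedSpace (EuclideanSpace ℝ (Fin d)) M]
    [IsManifold (𝓡 d) ∞ M] {Λ : Set M} (hΛ : IsCompact Λ) {ι : Type*} [Fintype ι]
    {C : ι → Set Λ} (hC : ∀ k, IsClopen (C k)) (c : ι → ℝ) :
    ∃ (r : M → ℝ) (κ : ℝ), ContMDiff (𝓡 d) 𝓘(ℝ, ℝ) ∞ r ∧ (∀ x, 0 < r x) ∧
      ∀ x : Λ, r x = κ + ∑ k, (C k).indicator (fun _ => c k) x := by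
  have hemb : IsClosedEmbedding (Subtype.val : Λ → M) := hΛ.isClosed.isClosedEmbedding_subtypeVal
  have hb : ∀ k, ∃ b : C^∞⟮𝓡 d, M; 𝓘(ℝ), ℝ⟯, EqOn b 0 (Subtype.val '' (C k)ᶜ) ∧
      EqOn b 1 (Subtype.val '' C k) ∧ ∀ x, b x ∈ Icc (0 : ℝ) 1 := fun k =>
    exists_contMDiffMap_zero_one_of_isClosed (𝓡 d)
      (hemb.isClosedMap _ (hC k).compl.1) (hemb.isClosedMap _ (hC k).1)
      (disjoint_image_of_injective Subtype.val_injective disjoint_compl_left)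
  choose b hb0 hb1 hb using hb
  -- The bumps take values in `[0, 1]`, so this constant keeps the roof at least `1` on all of `M`.
  refine ⟨fun x => (1 + ∑ k, |c k|) + ∑ k, c k * b k x, 1 + ∑ k, |c k|, ?_, fun x => ?_,
    fun x => ?_⟩
  · have hk : ∀ k, ContMDiff (𝓡 d) 𝓘(ℝ, ℝ) ∞ fun x => c k * b k x := fun k =>
      (contDiff_const.mul contDiff_id).contMDiff.comp (b k).contMDiff
    have hs : ContMDiff (𝓡 d) 𝓘(ℝ, ℝ) ∞ fun x => ∑ k, c k * b k x :=
      contMDiff_finsetSum fun k _ => hk k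
    exact ContMDiff.add contMDiff_const hs
  · have h : -∑ k, |c k| ≤ ∑ k, c k * b k x := by
      rw [← Finset.sum_neg_distrib]
      refine Finset.sum_le_sum fun k _ => ?_
      have h0 := (hb k x).1
      have h1 := (hb k x).2
      have := neg_abs_le (c k)
      nlinarith [abs_nonneg (c k)]
    linarith
  · refine congrArg _ (Finset.sum_congr rfl fun k _ => ?_)
    by_cases hx : x ∈ C k
    · rw [indicator_of_mem hx, hb1 k ⟨x, hx, rfl⟩]
      simp
    · rw [indicator_of_notMem hx, hb0 k ⟨x, hx, rfl⟩]
      simp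

theorem theorem1p5 {d : ℕ} {M : Type*} [EMetricSpace M] [CompactSpace M]
    [ChartedSpace (EuclideanSpace ℝ (Fin d)) M] [IsManifold (𝓡 d) ∞ M]
    [RiemannianBundle (fun x : M => TangentSpace (𝓡 d) x)]
    [IsContMDiffRiemannianBundle (𝓡 d) ∞ (EuclideanSpace ℝ (Fin d))
      (fun x : M => TangentSpace (𝓡 d) x)]
    [IsRiemannianManifold (𝓡 d) M]
    (f : M ≃ₘ^∞⟮𝓡 d, 𝓡 d⟯ M) (Λ : Set M)
    (hf : IsHyperbolicDiffeo f Λ) (hΛ : IsCantorSet Λ) :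
    ∃ ε₁ > (0 : ℝ≥0∞), ∀ ε : ℝ≥0∞, 0 < ε → ε ≤ ε₁ →
    ∃ δ₁ > (0 : ℝ≥0∞), ∀ δ : ℝ≥0∞, 0 < δ → δ ≤ δ₁ → ∀ x₀ ∈ Λ,
      (∀ α β : ℝ, ∃ r : M → ℝ, ContMDiff (𝓡 d) 𝓘(ℝ, ℝ) ∞ r ∧ (∀ x, 0 < r x) ∧ ∀ u₀ : ℝ,
        (∀ p ∈ temporalDomain f.toEquiv r Λ δ (x₀, u₀),
          ∃! T : ℝ, IsTemporalDistance f.toEquiv r Λ ε p.1 p.2 T) ∧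
        temporalRange f.toEquiv r Λ δ ε (x₀, u₀) = {0, α, -α, β, -β}) ∧
      (∃ r : M → ℝ, ContMDiff (𝓡 d) 𝓘(ℝ, ℝ) ∞ r ∧ (∀ x, 0 < r x) ∧ ∀ u₀ : ℝ,
        (∀ p ∈ temporalDomain f.toEquiv r Λ δ (x₀, u₀),
          ∃! T : ℝ, IsTemporalDistance f.toEquiv r Λ ε p.1 p.2 T) ∧
        (∃ a ∈ temporalRange f.toEquiv r Λ δ ε (x₀, u₀),
          ∃ b ∈ temporalRange f.toEquiv r Λ δ ε (x₀, u₀), IsDiophantine (a / b)) ∧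
        upperBoxDim (temporalRange f.toEquiv r Λ δ ε (x₀, u₀)) = 0) := by
  have : CompactSpace Λ := isCompact_iff_compactSpace.1 hΛ.isCompact
  have : TotallyDisconnectedSpace Λ :=
    totallyDisconnectedSpace_subtype_iff.2 hΛ.totallyDisconnected
  have : PerfectSpace Λ := hΛ.perfectSpace
  have hmem : ∀ x, f.toEquiv x ∈ Λ ↔ x ∈ Λ := fun x => by
    conv_lhs => rw [← hf.invariant]
    exact f.toEquiv.injective.mem_set_image
  let g : Equiv.Perm Λ := Equiv.Perm.subtypePerm f.toEquiv hmem
  have hsc : Function.Semiconj (Subtype.val : Λ → M) g f.toEquiv := fun _ => rfl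
  have hiso : Isometry (Subtype.val : Λ → M) := isometry_subtype_coe
  have hg : Continuous g :=
    Continuous.subtype_mk (f.continuous.comp continuous_subtype_val) _
  have hg' : Continuous g.symm := by
    refine continuous_induced_rng.2 ?_
    exact (f.symm.continuous.comp continuous_subtype_val).congr fun x =>
      ((semiconj_symm hsc).eq x).symm
  have hper : Dense (Function.periodicPts g) := by
    intro x
    rw [closure_subtype]
    refine closure_mono ?_ (hf.dense_periodic x.2)
    rintro y ⟨hy, n, hn, hyn⟩
    refine ⟨⟨y, hy⟩, ⟨n, hn, Subtype.ext ?_⟩, rfl⟩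
    rw [(hsc.iterate_right n).eq]
    exact hyn
  obtain ⟨ε₀, hε₀, hlp⟩ := hf.local_product
  have hlp' : ∀ ε : ℝ≥0∞, 0 < ε → ε ≤ ε₀ → ∃ δ > (0 : ℝ≥0∞), HasLocalProduct g ε δ := by
    intro ε hε hε'
    obtain ⟨δ, hδ, h⟩ := hlp ε hε hε'
    refine ⟨δ, hδ, fun x y hxy => ?_⟩
    obtain ⟨z, hz, hxyz⟩ := h x x.2 y y.2 hxy
    refine ⟨⟨z, hz⟩, ?_⟩
    ext w
    rw [mem_singleton_iff, Subtype.ext_iff, ← mem_singleton_iff (b := z), ← hxyz]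
    exact and_congr (mem_localStableSet_isometry_iff hiso hsc).symm
      (mem_localStableSet_isometry_iff hiso (semiconj_symm hsc)).symm
  refine ⟨ε₀, hε₀, fun ε hε hε' => ?_⟩
  obtain ⟨δ₁, hδ₁, hmark⟩ := exists_isMarkerFamily hg hg' hper hε₀ hlp' hε hε'
  refine ⟨δ₁, hδ₁, fun δ hδ hδ' x₀ hx₀ => ?_⟩
  have main : ∀ α β : ℝ, ∃ r : M → ℝ, ContMDiff (𝓡 d) 𝓘(ℝ, ℝ) ∞ r ∧ (∀ x, 0 < r x) ∧ ∀ u₀ : ℝ,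
        (∀ p ∈ temporalDomain f.toEquiv r Λ δ (x₀, u₀),
          ∃! T : ℝ, IsTemporalDistance f.toEquiv r Λ ε p.1 p.2 T) ∧
        temporalRange f.toEquiv r Λ δ ε (x₀, u₀) = {0, α, -α, β, -β} := by
    intro α β
    obtain ⟨C, K, hCK⟩ := hmark δ hδ hδ' ⟨x₀, hx₀⟩
    obtain ⟨K, rfl⟩ := Int.eq_ofNat_of_zero_le hCK.nonneg
    -- One marker for each nonzero value prescribed; coincidences among the four values are
    -- harmless.
    obtain ⟨r, κ, hr, hpos, hrC⟩ := exists_contMDiff_pos_eq_sum_indicator (d := d) hΛ.isCompact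
      hCK.isClopen ![α, -α, β, -β]
    refine ⟨r, hr, hpos, fun u₀ => ?_⟩
    obtain ⟨h1, h2⟩ := hCK.temporalRange_eq (R := r ∘ Subtype.val) hrC u₀
    have hrange : range (Subtype.val : Λ → M) = Λ := Subtype.range_val
    have hdom := fun p => mem_temporalDomain_isometry_iff (p := p) hiso hsc (r := r) (δ := δ)
      (z₀ := (⟨x₀, hx₀⟩, u₀))
    have hdist := fun z₁ z₂ T => isTemporalDistance_isometry_iff (z₁ := z₁) (z₂ := z₂) (T := T)
      hiso hsc (r := r) (ε := ε)
    have hran := temporalRange_isometry hiso hsc r δ ε (⟨x₀, hx₀⟩, u₀)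
    simp only [hrange, Prod.map_apply, id_eq] at hdom hdist hran
    refine ⟨fun p hp => ?_, ?_⟩
    · obtain ⟨q, hq, rfl⟩ := (hdom p).1 hp
      simpa only [hdist] using h1 q hq
    · rw [hran, h2]
      ext T
      simp only [Matrix.range_cons, Matrix.range_empty, mem_insert_iff, mem_union,
        mem_singleton_iff, mem_empty_iff_false, or_false]
  refine ⟨main, ?_⟩
  obtain ⟨r, hr, hpos, h⟩ := main √2 1
  refine ⟨r, hr, hpos, fun u₀ => ⟨(h u₀).1, ?_, ?_⟩⟩
  · rw [(h u₀).2]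
    exact ⟨√2, by simp, 1, by simp, by simpa using isDiophantine_sqrt_two⟩
  · rw [(h u₀).2]
    exact upperBoxDim_eq_zero_of_finite (toFinite _) (insert_nonempty _ _)
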